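/- Let $\mathbb T=\mathbb R/(2\pi\mathbb Z)$ and, for $u\in L^2(\mathbb R_x\times\mathbb T_y)$ (complex-valued), let $\hat u(\xi,n)$, $(\xi,n)\in\mathbb R\times\mathbb Z$, be its Fourier transform, $\hat u(\xi,n)=\frac1{2\pi}\int_{\mathbb R\times\mathbb T}u(x,y)e^{-i(x\xi+ny)}\,dx\,dy$ (in the $L^2$ sense). Let $$\mathcal E=\Big\{u\in L^2(\mathbb R\times\mathbb T)\,:\ \sum_{n\in\mathbb Z}\int_{\mathbb R}(1+\xi^2+\xi^{-2}n^2)|\hat u(\xi,n)|^2\,d\xi<\infty\Big\},$$ and for $u\in\mathcal E$ let $\partial_x u,\ \partial_x^{-1}\partial_y u\in L^2(\mathbb R\times\mathbb T)$ be the functions with Fourier transforms $i\xi\,\hat u(\xi,n)$ and $(i\xi)^{-1}(in)\,\hat u(\xi,n)$. For $c>0$ put $$Q_c(x)=\sqrt{\tfrac c2}\,\tanh\Big(\sqrt{\tfrac c2}\,x\Big),\qquad \mathcal L_c=-\partial_x+\partial_x^{-1}\partial_y-2Q_c(x),$$ and let $(Q_c')^\perp$ be the orthogonal complement of $Q_c'$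 in $L^2(\mathbb R\times\mathbb T)$, i.e. the set of $u$ with $\int u(x,y)\,Q_c'(x)\,dx\,dy=0$. For $\varepsilon>0$ and $x_0\in\mathbb R$ let $\chi_\varepsilon(x)=\frac{1+\tanh(\varepsilon x)}2$ and $$\|u\|_{L^2_{\varepsilon,x_0}}=\Big(\int_{\mathbb R\times\mathbb T}\chi_\varepsilon(x+x_0)|u(x,y)|^2\,dx\,dy\Big)^{1/2},\qquad \|u\|_{\mathcal E_{\varepsilon,x_0}}=\|u\|_{L^2_{\varepsilon,x_0}}+\|\partial_xu\|_{L^2_{\varepsilon,x_0}}+\|\partial_x^{-1}\partial_yu\|_{L^2_{\varepsilon,x_0}}.$$ **Lemma.** Let $c>0$. Then there exist positive constants $\varepsilon_0$ and $C$ such that for every $\varepsilon\in(0,\varepsilon_0)$, every $x_0\in\mathbb R$ and every $w\in\mathcal E\cap(Q_c')^\perp$, $$\|\mathcal L_c w\|_{L^2_{\varepsilon,x_0}}\ \ge\ C\,\|w\|_{\mathcal E_{\varepsilon,x_0}}.$$ -/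

import Mathlib

noncomputable section

namespace KP

open MeasureTheory Real FourierTransform

/-- The torus `𝕋 = ℝ / 2πℤ` needs `0 < 2π`. Its `volume` has total mass `2π`. -/
instance fact_two_pi_pos : Fact (0 < 2 * π) := ⟨Real.two_pi_pos⟩

/-- The domain `ℝ_x × 𝕋_y`, with the product measure `dx dy`. -/
abbrev Cylinder : Type := ℝ × AddCircle (2 * π)

/-- The space `L²(ℝ × 𝕋)` of complex-valued functions. -/
abbrev L2 : Type := Lp ℂ 2 (volume : Measure Cylinder)

/-- The `n`-th Fourier mode `u_n(x) = (2π)⁻¹ ∫_𝕋 u(x,y) e^{-iny} dy` of `u` in the variable `y`. -/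
def modeFun (u : L2) (n : ℤ) (x : ℝ) : ℂ := fourierCoeff (fun y => u (x, y)) n

theorem memLp_modeFun (u : L2) (n : ℤ) : MemLp (modeFun u n) 2 (volume : Measure ℝ) := by
  have hu : StronglyMeasurable (u : Cylinder → ℂ) := Lp.stronglyMeasurable u
  have hm : StronglyMeasurable (modeFun u n) := by
    unfold modeFun fourierCoeff
    refine StronglyMeasurable.integral_prod_right
      (f := fun (x : ℝ) (t : AddCircle (2 * π)) => fourier (-n) t • u (x, t)) ?_
    have hf : StronglyMeasurable fun p : Cylinder => (fourier (-n) p.2 : ℂ) := ((map_continuous (fourier (T := 2 * π) (-n))).stronglyMeasurable).comp_measurable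
      measurable_snd
    exact hf.smul hu
  have hpt : ∀ x, ‖modeFun u n x‖ₑ ^ 2
      ≤ ∫⁻ y, ‖u (x, y)‖ₑ ^ 2 ∂(AddCircle.haarAddCircle (T := 2 * π)) := by
    intro x
    have hux : AEStronglyMeasurable (fun y => u (x, y)) (AddCircle.haarAddCircle (T := 2 * π)) :=
      (hu.comp_measurable measurable_prodMk_left).aestronglyMeasurable
    have h1 : ‖modeFun u n x‖ₑ ≤ eLpNorm (fun y => u (x, y)) 1
        (AddCircle.haarAddCircle (T := 2 * π)) := by
      rw [eLpNorm_one_eq_lintegral_enorm]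
      refine (enorm_integral_le_lintegral_enorm _).trans (le_of_eq ?_)
      refine lintegral_congr fun y => ?_
      rw [enorm_smul]
      have : ‖(fourier (-n) y : ℂ)‖ₑ = 1 := by
        rw [← ofReal_norm, fourier_apply, Circle.norm_coe, ENNReal.ofReal_one]
      rw [this, one_mul]
    have h2 := h1.trans (eLpNorm_le_eLpNorm_of_exponent_le (p := 1) (q := 2)
      (by norm_num) hux)
    refine (pow_le_pow_left' h2 2).trans (le_of_eq ?_)
    rw [eLpNorm_eq_lintegral_rpow_enorm_toReal (by norm_num) (by norm_num), ← ENNReal.rpow_natCast,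
      ← ENNReal.rpow_mul]
    simp
  have hfin : ∫⁻ p : Cylinder, ‖u p‖ₑ ^ 2 < ⊤ := by
    have h := lintegral_rpow_enorm_lt_top_of_eLpNorm_lt_top (p := 2) (by norm_num) (by norm_num)
      (Lp.memLp u).2
    simpa using h
  refine ⟨hm.aestronglyMeasurable, ?_⟩
  rw [eLpNorm_lt_top_iff_lintegral_rpow_enorm_lt_top (by norm_num) (by norm_num)]
  have hle : ∫⁻ x, ‖modeFun u n x‖ₑ ^ 2
      ≤ ∫⁻ x, ∫⁻ y, ‖u (x, y)‖ₑ ^ 2 ∂(AddCircle.haarAddCircle (T := 2 * π)) :=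
    lintegral_mono hpt
  have hmeas : Measurable fun p : Cylinder => ‖u p‖ₑ ^ 2 := hu.enorm.pow_const 2
  have hvol : ∀ g : Cylinder → ENNReal, Measurable g → ∫⁻ p : Cylinder, g p =
      ENNReal.ofReal (2 * π) *
        ∫⁻ x, ∫⁻ y, g (x, y) ∂(AddCircle.haarAddCircle (T := 2 * π)) := by
    intro g hg
    rw [Measure.volume_eq_prod, lintegral_prod _ hg.aemeasurable,
      AddCircle.volume_eq_smul_haarAddCircle]
    simp_rw [lintegral_smul_measure, smul_eq_mul]
    rw [lintegral_const_mul']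
    exact ENNReal.ofReal_ne_top
  have hlt : ∫⁻ x, ‖modeFun u n x‖ₑ ^ 2 < ⊤ := by
    refine hle.trans_lt (lt_top_iff_ne_top.2 fun htop => ?_)
    rw [hvol _ hmeas, htop, ENNReal.mul_top (by simpa using Real.pi_pos)] at hfin
    exact lt_irrefl _ hfin
  simpa using hlt

/-- The Fourier mode `u_n` as an element of `L²(ℝ)`. -/
def mode (u : L2) (n : ℤ) : Lp ℂ 2 (volume : Measure ℝ) := (memLp_modeFun u n).toLp (modeFun u n)

/-- The Fourier transform on `ℝ × 𝕋` in the unitary normalization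
`û(ξ,n) = (2π)⁻¹ ∫∫ u(x,y) e^{-i(xξ + ny)} dx dy`, for `u ∈ L²(ℝ × 𝕋)`: here `𝓕` is the `L²(ℝ)`
Fourier transform with kernel `e^{-2πixη}`, whence the argument `η = ξ / 2π`. -/
def hat (u : L2) (n : ℤ) (ξ : ℝ) : ℂ := (𝓕 (mode u n) : Lp ℂ 2 (volume : Measure ℝ)) (ξ / (2 * π))

/-- The space `𝓔(ℝ × 𝕋)`: those `u ∈ L²` with `∑ₙ ∫ (1 + ξ² + ξ⁻² n²) |û(ξ,n)|² dξ < ∞`. -/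
def spaceE : Set L2 :=
  {u | ∑' n : ℤ, ∫⁻ ξ : ℝ, ENNReal.ofReal (1 + ξ ^ 2 + (ξ ^ 2)⁻¹ * (n : ℝ) ^ 2) * ‖hat u n ξ‖ₑ ^ 2 < ⊤}

open Classical in
/-- The Fourier multiplier with symbol `m`: the (unique) `v ∈ L²(ℝ × 𝕋)` with
`v̂(ξ,n) = m(ξ,n) û(ξ,n)`, which exists exactly if the right-hand side is square-integrable
over `ℝ × ℤ` (and the value `0` otherwise). -/
def multiplier (m : ℝ → ℤ → ℂ) (u : L2) : L2 :=
  if h : ∃ v : L2, ∀ n : ℤ, ∀ᵐ ξ : ℝ, hat v n ξ = m ξ n * hat u n ξ then h.choose else 0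

/-- The operator `∂_x`, with symbol `iξ`. -/
def dx (u : L2) : L2 := multiplier (fun ξ _ => Complex.I * ξ) u

/-- The operator `∂_x⁻¹ ∂_y`, with symbol `(iξ)⁻¹ (in)`. -/
def dxInvDy (u : L2) : L2 := multiplier (fun ξ n => (Complex.I * ξ)⁻¹ * (Complex.I * n)) u

/-- The kink `Q_c(x) = √(c/2) tanh(√(c/2) x)`. -/
def kink (c x : ℝ) : ℝ := √(c / 2) * Real.tanh (√(c / 2) * x)

/-- The orthogonal complement of `Q_c'` (a real function of `x` alone) in `L²(ℝ × 𝕋)`. -/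
def kinkPerp (c : ℝ) : Set L2 :=
  {u | ∫ p : Cylinder, ((deriv (kink c) p.1 : ℝ) : ℂ) * u p = 0}

/-- The operator `𝓛_c = -∂_x + ∂_x⁻¹∂_y - 2 Q_c(x)`. -/
def linOp (c : ℝ) (u : L2) (p : Cylinder) : ℂ :=
  - dx u p + dxInvDy u p - 2 * (kink c p.1 : ℂ) * u p

/-- The weight `χ_ε(x) = (1 + tanh (ε x)) / 2`. -/
def chi (ε x : ℝ) : ℝ := (1 + Real.tanh (ε * x)) / 2

/-- The norm of `L²_{ε,x₀}`: `(∫ χ_ε(x + x₀) |u(x,y)|² dx dy)^{1/2}`. -/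
def weightedL2Norm (ε x₀ : ℝ) (u : Cylinder → ℂ) : ℝ :=
  √(∫ p : Cylinder, chi ε (p.1 + x₀) * ‖u p‖ ^ 2)

/-- The norm of `𝓔_{ε,x₀}`. -/
def weightedENorm (ε x₀ : ℝ) (u : L2) : ℝ :=
  weightedL2Norm ε x₀ u + weightedL2Norm ε x₀ (dx u) + weightedL2Norm ε x₀ (dxInvDy u)

end KP

end

noncomputable section

namespace KP

open MeasureTheory Filter Topology FourierTransform ComplexConjugate
open scoped ENNReal BoundedContinuousFunction

/-! The weight and the coefficients of `𝓛_c` depend on `x` alone, so Fourier series in `y` reduce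
everything to estimates for each mode `n`, uniform in `n`; Parseval in `y` with weight `χ(x)` then
sums them. Put `a = √(c/2)`, so that `Q' = a² - Q²` and `|Q| ≤ a`. For the modes `w, v, f` of the
function, of `∂_x⁻¹∂_y w` and of `𝓛_c w`, the relations are `v' = i n w` and `f = -w' + v - 2Q w`.

For `n ≠ 0` put `ν = i n`. Eliminating `w` gives `v'' + 2Q v' - ν v = -ν f`, and since `(∂ + Q)² =
∂² + 2Q∂ + a²` the left side is `(∂ + Q - μ)(∂ + Q + μ)v` with `μ² = a² + ν`. The two factors may be
taken in either order, so `p = v' + Q v + μ v` and `q = v' + Q v - μ v` solve the first-order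
equations `p' = (μ - Q)p - ν f` and `q' = (-μ - Q)q - ν f`. As `Re μ > a ≥ |Q|`, the real parts of
both coefficients stay away from zero, and a weighted energy identity bounds `p` and `q`
(`dissipative_estimate`). Then `v` and `w` follow from `p - q = 2μv` and `p + q = 2νw + 2Qv`. The
gap `Re μ - a` satisfies `n² ≤ K (Re μ - a)² |μ|²`, which compensates the factor `|ν|²` and makes
the bounds uniform (`exists_root`).

For `n = 0` one has `v = 0` and `f = -(∂ + 2Q)w`, whose kernel is spanned by `Q'`; this is where
orthogonality enters. The orthogonal complement of `Q'` is contained in the range of the adjoint `∂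
- 2Q` on `H¹` (`mem_range_adjointOp`), so `w = u' - 2Qu`, and `-f = u'' - (2a² + 2Q²)u` has a
strictly positive potential. Pairing with `χ u` controls `u` and `u'`, hence `w`
(`zero_mode_estimate`).

Finally `∂_x w` is read off from the equation. The weight enters only through `0 ≤ χ' ≤ 2εχ`, so
commutator terms are absorbed for small `ε`, with constants independent of `x₀`. -/

/-- The space `L²(ℝ)` of complex-valued functions. -/
abbrev LineL2 : Type := Lp ℂ 2 (volume : Measure ℝ)

/-! ### Bounded multipliers and weak derivatives on `L²(ℝ)` -/

theorem memLp_bcf_mul (m : ℝ →ᵇ ℂ) {h : ℝ → ℂ} (hh : MemLp h 2 (volume : Measure ℝ)) :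
    MemLp (fun x => m x * h x) 2 (volume : Measure ℝ) :=
  hh.of_le_mul (c := ‖m‖) (m.continuous.aestronglyMeasurable.mul hh.1)
    (ae_of_all _ fun x => by
      rw [norm_mul]; exact mul_le_mul_of_nonneg_right (m.norm_coe_le_norm x) (norm_nonneg _))

/-- Multiplication by a bounded continuous function on `L²(ℝ)`. -/
def mulCLM (m : ℝ →ᵇ ℂ) : LineL2 →L[ℂ] LineL2 :=
  LinearMap.mkContinuous
    { toFun := fun h => (memLp_bcf_mul m (Lp.memLp h)).toLp _
      map_add' := fun h k => by
        ext1
        filter_upwards [(memLp_bcf_mul m (Lp.memLp (h + k))).coeFn_toLp,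
          (memLp_bcf_mul m (Lp.memLp h)).coeFn_toLp, (memLp_bcf_mul m (Lp.memLp k)).coeFn_toLp,
          Lp.coeFn_add ((memLp_bcf_mul m (Lp.memLp h)).toLp _)
            ((memLp_bcf_mul m (Lp.memLp k)).toLp _), Lp.coeFn_add h k] with x h1 h2 h3 h4 h5
        rw [h1, h4, Pi.add_apply, h2, h3, h5, Pi.add_apply, mul_add]
      map_smul' := fun c h => by
        ext1
        filter_upwards [(memLp_bcf_mul m (Lp.memLp (c • h))).coeFn_toLp,
          (memLp_bcf_mul m (Lp.memLp h)).coeFn_toLp,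
          Lp.coeFn_smul c ((memLp_bcf_mul m (Lp.memLp h)).toLp _),
          Lp.coeFn_smul c h] with x h1 h2 h3 h4
        rw [h1, RingHom.id_apply, h3, Pi.smul_apply, h2, h4, Pi.smul_apply, smul_eq_mul,
          smul_eq_mul]
        ring }
    ‖m‖ fun h => by
      refine Lp.norm_le_mul_norm_of_ae_le_mul ?_
      filter_upwards [(memLp_bcf_mul m (Lp.memLp h)).coeFn_toLp] with x h1
      change ‖((memLp_bcf_mul m (Lp.memLp h)).toLp _ : LineL2) x‖ ≤ _
      rw [h1, norm_mul]
      exact mul_le_mul_of_nonneg_right (m.norm_coe_le_norm x) (norm_nonneg _)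

theorem coeFn_mulCLM (m : ℝ →ᵇ ℂ) (h : LineL2) : mulCLM m h =ᵐ[volume] fun x => m x * h x :=
  (memLp_bcf_mul m (Lp.memLp h)).coeFn_toLp

/-- Pairs `(φ, φ')` with `φ` differentiable and both functions square-integrable. -/
def smoothPairs : Submodule ℂ (LineL2 × LineL2) where
  carrier := {p | ∃ φ ψ : ℝ → ℂ, (∀ x, HasDerivAt φ (ψ x) x) ∧ p.1 =ᵐ[volume] φ ∧ p.2 =ᵐ[volume] ψ}
  add_mem' := by
    rintro p q ⟨φ, ψ, h1, h2, h3⟩ ⟨φ', ψ', h1', h2', h3'⟩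
    exact ⟨φ + φ', ψ + ψ', fun x => (h1 x).add (h1' x),
      (Lp.coeFn_add _ _).trans (h2.add h2'), (Lp.coeFn_add _ _).trans (h3.add h3')⟩
  zero_mem' := ⟨0, 0, fun x => hasDerivAt_const x 0, Lp.coeFn_zero _ _ _, Lp.coeFn_zero _ _ _⟩
  smul_mem' := by
    rintro c p ⟨φ, ψ, h1, h2, h3⟩
    exact ⟨c • φ, c • ψ, fun x => (h1 x).const_smul c,
      (Lp.coeFn_smul _ _).trans (h2.const_smul c), (Lp.coeFn_smul _ _).trans (h3.const_smul c)⟩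

/-- `h ∈ H¹(ℝ)` with derivative `g`: the pair is an `L²`-limit of smooth pairs. -/
def HasL2Deriv (h g : LineL2) : Prop := (h, g) ∈ smoothPairs.topologicalClosure

theorem HasL2Deriv.add {h g h' g' : LineL2} (H : HasL2Deriv h g) (H' : HasL2Deriv h' g') :
    HasL2Deriv (h + h') (g + g') := Submodule.add_mem _ H H'

theorem HasL2Deriv.const_smul {h g : LineL2} (c : ℂ) (H : HasL2Deriv h g) :
    HasL2Deriv (c • h) (c • g) := Submodule.smul_mem _ c H

/-- The Leibniz rule is pointwise on smooth pairs, and `(h, g) ↦ (m h, m' h + m g)` is continuous,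
so it maps the closure into the closure. -/
theorem HasL2Deriv.mul {h g : LineL2} (H : HasL2Deriv h g) {m m' : ℝ →ᵇ ℂ}
    (hm : ∀ x, HasDerivAt m (m' x) x) :
    HasL2Deriv (mulCLM m h) (mulCLM m' h + mulCLM m g) := by
  refine map_mem_closure (t := (smoothPairs : Set (LineL2 × LineL2)))
    (f := fun p : LineL2 × LineL2 => (mulCLM m p.1, mulCLM m' p.1 + mulCLM m p.2))
    (by fun_prop) H ?_
  rintro p ⟨φ, ψ, h1, h2, h3⟩
  refine ⟨fun x => m x * φ x, fun x => m' x * φ x + m x * ψ x, fun x => (hm x).mul (h1 x), ?_, ?_⟩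
  · filter_upwards [coeFn_mulCLM m p.1, h2] with x h4 h5
    rw [h4, h5]
  · filter_upwards [coeFn_mulCLM m p.2, coeFn_mulCLM m' p.1, h2, h3,
      Lp.coeFn_add (mulCLM m' p.1) (mulCLM m p.2)] with x h4 h5 h6 h7 h8
    rw [h8, Pi.add_apply, h4, h5, h6, h7]

theorem inner_eq_integral (k g : LineL2) :
    inner ℂ k g = ∫ x, g x * conj (k x) := by
  rw [L2.inner_def]; rfl

theorem integrable_mul_conj (k g : LineL2) : Integrable fun x => g x * conj (k x) :=
  L2.integrable_inner k g

theorem smoothPairs_inner {p q : LineL2 × LineL2} (hp : p ∈ smoothPairs) (hq : q ∈ smoothPairs) :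
    inner ℂ q.1 p.2 + inner ℂ q.2 p.1 = 0 := by
  obtain ⟨φ, ψ, h1, h2, h3⟩ := hp
  obtain ⟨κ, l, h1', h2', h3'⟩ := hq
  have e1 : (fun x => p.2 x * conj (q.1 x)) =ᵐ[volume] fun x => ψ x * conj (κ x) := by
    filter_upwards [h3, h2'] with x a b
    rw [a, b]
  have e2 : (fun x => p.1 x * conj (q.2 x)) =ᵐ[volume] fun x => φ x * conj (l x) := by
    filter_upwards [h2, h3'] with x a b
    rw [a, b]
  have e3 : (fun x => p.1 x * conj (q.1 x)) =ᵐ[volume] fun x => φ x * conj (κ x) := by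
    filter_upwards [h2, h2'] with x a b
    rw [a, b]
  have i1 := (integrable_mul_conj q.1 p.2).congr e1
  have i2 := (integrable_mul_conj q.2 p.1).congr e2
  have i3 := (integrable_mul_conj q.1 p.1).congr e3
  rw [inner_eq_integral, inner_eq_integral, integral_congr_ae e1, integral_congr_ae e2,
    ← integral_add i1 i2]
  refine integral_eq_zero_of_hasDerivAt_of_integrable (fun x => (h1 x).mul ?_) (i1.add i2) i3
  exact (h1' x).star

/-- Integration by parts. -/
theorem HasL2Deriv.inner_add_inner {h g k l : LineL2} (H : HasL2Deriv h g) (K : HasL2Deriv k l) :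
    inner ℂ k g + inner ℂ l h = 0 := by
  have key : ∀ q ∈ smoothPairs, ∀ p ∈ smoothPairs.topologicalClosure,
      inner ℂ q.1 p.2 + inner ℂ q.2 p.1 = 0 := by
    intro q hq p hp
    have hc : IsClosed {p : LineL2 × LineL2 | inner ℂ q.1 p.2 + inner ℂ q.2 p.1 = 0} :=
      isClosed_eq (by fun_prop) continuous_const
    exact closure_minimal (fun p hp => smoothPairs_inner hp hq) hc hp
  have hc : IsClosed {q : LineL2 × LineL2 | inner ℂ q.1 g + inner ℂ q.2 h = 0} :=
    isClosed_eq (by fun_prop) continuous_const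
  exact closure_minimal (fun q hq => key q hq (h, g) H) hc K

/-! ### Fourier characterization of weak derivatives -/

theorem hasTemperateGrowth_bessel : (fun η : ℝ => (1 + ‖η‖ ^ 2) ^ (-1 / 2 : ℝ)).HasTemperateGrowth :=
  Function.hasTemperateGrowth_one_add_norm_sq_rpow ℝ (-1 / 2)

theorem bessel_pos (η : ℝ) : 0 < (1 + ‖η‖ ^ 2) ^ (-1 / 2 : ℝ) := by positivity

theorem bessel_mul_sqrt (η : ℝ) : (1 + ‖η‖ ^ 2) ^ (-1 / 2 : ℝ) * √(1 + ‖η‖ ^ 2) = 1 := by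
  rw [Real.sqrt_eq_rpow, ← Real.rpow_add (by positivity)]
  norm_num

theorem bessel_le_one (η : ℝ) : (1 + ‖η‖ ^ 2) ^ (-1 / 2 : ℝ) ≤ 1 := by
  have h1 : 1 ≤ √(1 + ‖η‖ ^ 2) := Real.one_le_sqrt.2 (by nlinarith [sq_nonneg ‖η‖])
  nlinarith [bessel_mul_sqrt η, bessel_pos η]

theorem abs_mul_bessel_le_one (η : ℝ) : |η| * (1 + ‖η‖ ^ 2) ^ (-1 / 2 : ℝ) ≤ 1 := by
  have h1 : |η| ≤ √(1 + ‖η‖ ^ 2) := Real.le_sqrt_of_sq_le (by simp)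
  nlinarith [bessel_mul_sqrt η, bessel_pos η]

/-- The multiplier `(1 + η²)^{-1/2}`. -/
def besselBCF : ℝ →ᵇ ℂ :=
  BoundedContinuousFunction.ofNormedAddCommGroup
    (fun η => (((1 + ‖η‖ ^ 2) ^ (-1 / 2 : ℝ) : ℝ) : ℂ))
    (Complex.continuous_ofReal.comp hasTemperateGrowth_bessel.1.continuous) 1 fun η => by
      rw [Complex.norm_of_nonneg (bessel_pos η).le]; exact bessel_le_one η

/-- The multiplier `2πiη (1 + η²)^{-1/2}`. -/
def derivBesselBCF : ℝ →ᵇ ℂ :=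
  BoundedContinuousFunction.ofNormedAddCommGroup
    (fun η => 2 * Real.pi * Complex.I * (η * (((1 + ‖η‖ ^ 2) ^ (-1 / 2 : ℝ) : ℝ) : ℂ)))
    (continuous_const.mul (Complex.continuous_ofReal.mul
      (Complex.continuous_ofReal.comp hasTemperateGrowth_bessel.1.continuous)))
    (2 * Real.pi) fun η => by
      have h := mul_le_mul_of_nonneg_left (abs_mul_bessel_le_one η) Real.two_pi_pos.le
      simp only [norm_mul, Complex.norm_I, Complex.norm_real, Real.norm_eq_abs, abs_of_pos Real.pi_pos,
        RCLike.norm_ofNat, mul_one] at h ⊢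
      have h' := bessel_pos η
      rw [Real.norm_eq_abs] at h'
      rwa [abs_of_pos h']

/-- Functions whose Fourier transforms are related by `ĝ = 2πiη ĥ` form a derivative pair. -/
theorem hasL2Deriv_of_fourier {h g : LineL2}
    (hg : ∀ᵐ η : ℝ, (𝓕 g : LineL2) η = 2 * Real.pi * Complex.I * η * (𝓕 h : LineL2) η) :
    HasL2Deriv h g := by
  have hG : MemLp (fun η : ℝ => (√(1 + ‖η‖ ^ 2) : ℂ) * (𝓕 h : LineL2) η) 2 volume := by
    refine ((Lp.memLp (𝓕 h : LineL2)).norm.add (Lp.memLp (𝓕 g : LineL2)).norm).of_le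
      (AEStronglyMeasurable.mul (by fun_prop) (Lp.aestronglyMeasurable _)) ?_
    filter_upwards [hg] with η hη
    have h1 : √(1 + ‖η‖ ^ 2) ≤ 1 + |η| :=
      Real.sqrt_le_iff.2 ⟨by positivity, by
        rw [Real.norm_eq_abs]; nlinarith [abs_nonneg η]⟩
    rw [Pi.add_apply, hη]
    simp only [norm_mul, Complex.norm_I, Complex.norm_real, Real.norm_eq_abs, abs_of_pos Real.pi_pos,
        RCLike.norm_ofNat, mul_one, abs_of_nonneg (Real.sqrt_nonneg _)] at h1 ⊢
    refine le_trans ?_ (le_abs_self _)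
    have h2 : 1 ≤ 2 * Real.pi := by linarith [Real.pi_gt_three]
    have h3 := mul_le_mul_of_nonneg_right h1 (norm_nonneg ((𝓕 h : LineL2) η))
    have h4 := mul_le_mul_of_nonneg_right h2
      (mul_nonneg (abs_nonneg η) (norm_nonneg ((𝓕 h : LineL2) η)))
    linarith
  -- `H¹` is parametrized by `G = (1 + η²)^{1/2} ĥ` in `L²`: both symbols in `Φ` are bounded, so `Φ`
  -- is continuous, and it sends Schwartz functions to smooth pairs. Density of Schwartz functions
  -- then puts `(h, g) = Φ G` in the closure.
  let Φ : LineL2 → LineL2 × LineL2 := fun G =>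
    ((Lp.fourierTransformₗᵢ ℝ ℂ).symm (mulCLM besselBCF G),
      (Lp.fourierTransformₗᵢ ℝ ℂ).symm (mulCLM derivBesselBCF G))
  have hΦ : Continuous Φ := by
    refine Continuous.prodMk ?_ ?_
    · exact (LinearIsometryEquiv.continuous _).comp (mulCLM _).continuous
    · exact (LinearIsometryEquiv.continuous _).comp (mulCLM _).continuous
  have hval : Φ hG.toLp = (h, g) := by
    refine Prod.ext ?_ ?_
    · change (Lp.fourierTransformₗᵢ ℝ ℂ).symm _ = _
      rw [LinearIsometryEquiv.symm_apply_eq]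
      ext1
      filter_upwards [coeFn_mulCLM besselBCF hG.toLp, hG.coeFn_toLp] with η h1 h2
      rw [h1, h2]
      change (((1 + ‖η‖ ^ 2) ^ (-1 / 2 : ℝ) : ℝ) : ℂ) * _ = (𝓕 h : LineL2) η
      rw [← mul_assoc, ← Complex.ofReal_mul, bessel_mul_sqrt, Complex.ofReal_one, one_mul]
    · change (Lp.fourierTransformₗᵢ ℝ ℂ).symm _ = _
      rw [LinearIsometryEquiv.symm_apply_eq]
      ext1
      filter_upwards [coeFn_mulCLM derivBesselBCF hG.toLp, hG.coeFn_toLp, hg] with η h1 h2 h3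
      rw [h1, h2]
      change _ = (𝓕 g : LineL2) η
      rw [h3]
      change 2 * Real.pi * Complex.I * (η * (((1 + ‖η‖ ^ 2) ^ (-1 / 2 : ℝ) : ℝ) : ℂ)) * _ = _
      have := congrArg (fun t : ℝ => (t : ℂ)) (bessel_mul_sqrt η)
      simp only [Complex.ofReal_mul, Complex.ofReal_one] at this
      linear_combination (2 * Real.pi * Complex.I * η * (𝓕 h : LineL2) η) * this
  change (h, g) ∈ closure (smoothPairs : Set (LineL2 × LineL2))
  rw [← hval]
  refine map_mem_closure hΦ
    (SchwartzMap.denseRange_toLpCLM (F := ℂ) (p := 2) (μ := (volume : Measure ℝ))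
      (by norm_num) hG.toLp) ?_
  rintro _ ⟨ψ, rfl⟩
  have hbC : (fun η : ℝ => (((1 + ‖η‖ ^ 2) ^ (-1 / 2 : ℝ) : ℝ) : ℂ)).HasTemperateGrowth :=
    Function.HasTemperateGrowth.comp (g := Complex.ofReal) (by fun_prop) hasTemperateGrowth_bessel
  have hi : (fun η : ℝ => inner ℝ η (1 : ℝ)).HasTemperateGrowth := by fun_prop
  let θ : SchwartzMap ℝ ℂ := SchwartzMap.smulLeftCLM ℂ
    (fun η : ℝ => (((1 + ‖η‖ ^ 2) ^ (-1 / 2 : ℝ) : ℝ) : ℂ)) ψ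
  let κ : SchwartzMap ℝ ℂ :=
    (2 * Real.pi * Complex.I) • SchwartzMap.smulLeftCLM ℂ (fun η : ℝ => inner ℝ η (1 : ℝ)) θ
  have e1 : mulCLM besselBCF (ψ.toLp 2) = θ.toLp 2 := by
    ext1
    filter_upwards [coeFn_mulCLM besselBCF (ψ.toLp 2), ψ.coeFn_toLp 2, θ.coeFn_toLp 2]
      with η h1 h2 h3
    rw [h1, h2, h3, SchwartzMap.smulLeftCLM_apply_apply hbC]
    rfl
  have e2 : mulCLM derivBesselBCF (ψ.toLp 2) = κ.toLp 2 := by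
    ext1
    filter_upwards [coeFn_mulCLM derivBesselBCF (ψ.toLp 2), ψ.coeFn_toLp 2, κ.coeFn_toLp 2]
      with η h1 h2 h3
    rw [h1, h2, h3, smul_apply, SchwartzMap.smulLeftCLM_apply_apply hi,
      SchwartzMap.smulLeftCLM_apply_apply hbC]
    simp only [RCLike.inner_apply, smul_eq_mul, Complex.real_smul]
    simp only [one_mul, conj_trivial]
    change 2 * Real.pi * Complex.I * (η * (((1 + ‖η‖ ^ 2) ^ (-1 / 2 : ℝ) : ℝ) : ℂ)) * _ = _
    ring
  have h1 : LineDeriv.lineDerivOp (1 : ℝ) (𝓕⁻ θ : SchwartzMap ℝ ℂ) = 𝓕⁻ κ :=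
    SchwartzMap.lineDerivOp_fourierInv_eq θ (1 : ℝ)
  clear_value θ κ
  refine ⟨(𝓕⁻ θ : SchwartzMap ℝ ℂ), (𝓕⁻ κ : SchwartzMap ℝ ℂ), fun x => ?_, ?_, ?_⟩
  · have h2 := (𝓕⁻ θ : SchwartzMap ℝ ℂ).hasDerivAt x
    have h3 : deriv (𝓕⁻ θ : SchwartzMap ℝ ℂ) x = (𝓕⁻ κ : SchwartzMap ℝ ℂ) x := by
      rw [← h1, SchwartzMap.lineDerivOp_apply_eq_fderiv]
      simp
    rwa [h3] at h2
  · have : (Φ (SchwartzMap.toLpCLM ℝ ℂ 2 volume ψ)).1 = (𝓕⁻ θ).toLp 2 := by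
      refine Eq.trans ?_ (SchwartzMap.toLp_fourierInv_eq θ)
      exact congrArg (Lp.fourierTransformₗᵢ ℝ ℂ).symm e1
    have hae := SchwartzMap.coeFn_toLp (𝓕⁻ θ : SchwartzMap ℝ ℂ) 2 (volume : Measure ℝ)
    exact (Lp.ext_iff.1 this).trans hae
  · have : (Φ (SchwartzMap.toLpCLM ℝ ℂ 2 volume ψ)).2 = (𝓕⁻ κ).toLp 2 := by
      refine Eq.trans ?_ (SchwartzMap.toLp_fourierInv_eq κ)
      exact congrArg (Lp.fourierTransformₗᵢ ℝ ℂ).symm e2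
    have hae := SchwartzMap.coeFn_toLp (𝓕⁻ κ : SchwartzMap ℝ ℂ) 2 (volume : Measure ℝ)
    exact (Lp.ext_iff.1 this).trans hae

/-! ### Weighted energies and first-order equations -/

/-- A real bounded continuous function, seen as a complex one. -/
def ofRealBCF (χ : ℝ →ᵇ ℝ) : ℝ →ᵇ ℂ :=
  BoundedContinuousFunction.ofNormedAddCommGroup (fun x => (χ x : ℂ))
    (Complex.continuous_ofReal.comp χ.continuous) ‖χ‖ fun x => by
      rw [Complex.norm_real]; exact χ.norm_coe_le_norm x

@[simp] theorem ofRealBCF_apply (χ : ℝ →ᵇ ℝ) (x : ℝ) : ofRealBCF χ x = (χ x : ℂ) := rfl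

theorem integrable_bcf_mul_re (χ : ℝ →ᵇ ℝ) (h k : LineL2) :
    Integrable fun x => χ x * (h x * conj (k x)).re :=
  (integrable_mul_conj k h).re.bdd_mul χ.continuous.aestronglyMeasurable
    (ae_of_all _ fun x => χ.norm_coe_le_norm x)

theorem re_inner_mulCLM_ofReal (χ : ℝ →ᵇ ℝ) (h k : LineL2) :
    (inner ℂ k (mulCLM (ofRealBCF χ) h)).re = ∫ x, χ x * (h x * conj (k x)).re := by
  rw [inner_eq_integral, ← RCLike.re_eq_complex_re, ← integral_re (integrable_mul_conj _ _)]
  refine integral_congr_ae ?_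
  filter_upwards [coeFn_mulCLM (ofRealBCF χ) h] with x hx
  rw [hx, RCLike.re_eq_complex_re, ofRealBCF_apply, mul_assoc, Complex.re_ofReal_mul]

/-- Integration by parts with a weight. -/
theorem HasL2Deriv.weighted {χ χ' : ℝ →ᵇ ℝ} (hχ : ∀ x, HasDerivAt χ (χ' x) x)
    {h g k l : LineL2} (H : HasL2Deriv h g) (K : HasL2Deriv k l) :
    ∫ x, (χ' x * (h x * conj (k x)).re + χ x * (g x * conj (k x)).re
      + χ x * (h x * conj (l x)).re) = 0 := by
  have hχc : ∀ x, HasDerivAt (ofRealBCF χ) (ofRealBCF χ' x) x := fun x => (hχ x).ofReal_comp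
  have key := congrArg Complex.re ((H.mul hχc).inner_add_inner K)
  rw [inner_add_right, Complex.add_re, Complex.add_re, re_inner_mulCLM_ofReal,
    re_inner_mulCLM_ofReal, re_inner_mulCLM_ofReal, Complex.zero_re] at key
  have hi : Integrable fun x => χ' x * (h x * conj (k x)).re + χ x * (g x * conj (k x)).re :=
    (integrable_bcf_mul_re χ' h k).add (integrable_bcf_mul_re χ g k)
  rw [← integral_add (integrable_bcf_mul_re χ' h k) (integrable_bcf_mul_re χ g k),
    ← integral_add hi (integrable_bcf_mul_re χ h l)] at key
  exact key

/-- The weighted energy `∫ χ |h|²`. -/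
def energy (χ : ℝ →ᵇ ℝ) (h : LineL2) : ℝ := ∫ x, χ x * ‖h x‖ ^ 2

theorem re_mul_conj_self (z : ℂ) : (z * conj z).re = ‖z‖ ^ 2 := by
  rw [Complex.mul_conj, Complex.ofReal_re, Complex.normSq_eq_norm_sq]

theorem integrable_energy (χ : ℝ →ᵇ ℝ) (h : LineL2) : Integrable fun x => χ x * ‖h x‖ ^ 2 := by
  refine (integrable_bcf_mul_re χ h h).congr (ae_of_all _ fun x => ?_)
  beta_reduce
  rw [re_mul_conj_self]

theorem energy_nonneg {χ : ℝ →ᵇ ℝ} (hχ : ∀ x, 0 ≤ χ x) (h : LineL2) : 0 ≤ energy χ h :=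
  integral_nonneg fun x => mul_nonneg (hχ x) (by positivity)

theorem energy_le {χ : ℝ →ᵇ ℝ} (hχ : ∀ x, 0 ≤ χ x) {h p q : LineL2} {A B : ℝ}
    (hle : ∀ᵐ x, ‖h x‖ ^ 2 ≤ A * ‖p x‖ ^ 2 + B * ‖q x‖ ^ 2) :
    energy χ h ≤ A * energy χ p + B * energy χ q := by
  unfold energy
  rw [← integral_const_mul, ← integral_const_mul, ← integral_add
    ((integrable_energy χ p).const_mul A) ((integrable_energy χ q).const_mul B)]
  refine integral_mono_ae (integrable_energy χ h)
    (((integrable_energy χ p).const_mul A).add ((integrable_energy χ q).const_mul B)) ?_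
  filter_upwards [hle] with x hx
  have := mul_le_mul_of_nonneg_left hx (hχ x)
  linarith

theorem energy_const_smul (χ : ℝ →ᵇ ℝ) (c : ℂ) (h : LineL2) :
    energy χ (c • h) = ‖c‖ ^ 2 * energy χ h := by
  unfold energy
  rw [← integral_const_mul]
  refine integral_congr_ae ?_
  filter_upwards [Lp.coeFn_smul c h] with x hx
  rw [hx, Pi.smul_apply, smul_eq_mul, norm_mul]
  ring

/-- A weight `χ` with `0 ≤ χ' ≤ 2εχ`. -/
structure SlowWeight (ε : ℝ) where
  /-- the weight -/
  χ : ℝ →ᵇ ℝ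
  /-- its derivative -/
  χ' : ℝ →ᵇ ℝ
  hasDerivAt : ∀ x, HasDerivAt χ (χ' x) x
  nonneg : ∀ x, 0 ≤ χ x
  deriv_nonneg : ∀ x, 0 ≤ χ' x
  deriv_le : ∀ x, χ' x ≤ 2 * ε * χ x

theorem norm_add_sq_le (x y : ℂ) : ‖x + y‖ ^ 2 ≤ 2 * ‖x‖ ^ 2 + 2 * ‖y‖ ^ 2 := by
  have h := norm_add_le x y
  nlinarith [sq_nonneg (‖x‖ - ‖y‖), norm_nonneg (x + y), norm_nonneg x, norm_nonneg y]

theorem norm_sub_sq_le (x y : ℂ) : ‖x - y‖ ^ 2 ≤ 2 * ‖x‖ ^ 2 + 2 * ‖y‖ ^ 2 := by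
  simpa [sub_eq_add_neg] using norm_add_sq_le x (-y)

theorem abs_re_mul_conj_le (x y : ℂ) : |(x * conj y).re| ≤ ‖x‖ * ‖y‖ := by
  refine (Complex.abs_re_le_norm _).trans ?_
  rw [norm_mul, RCLike.norm_conj]

/-- The weighted estimate for `h' = λ h + F` when `Re λ` stays away from `0`. -/
theorem dissipative_estimate {ε δ : ℝ} (W : SlowWeight ε) (hδ : 0 < δ) (hε : ε ≤ δ / 4)
    {h g F : LineL2} (H : HasL2Deriv h g) {lam : ℝ → ℂ}
    (hg : ∀ᵐ x, g x = lam x * h x + F x)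
    (hlam : (∀ x, δ ≤ (lam x).re) ∨ ∀ x, (lam x).re ≤ -δ) :
    δ ^ 2 * energy W.χ h ≤ 2 * energy W.χ F := by
  have ibp := H.weighted W.hasDerivAt H
  have hint : Integrable fun x => W.χ' x * (h x * conj (h x)).re + W.χ x * (g x * conj (h x)).re
      + W.χ x * (h x * conj (g x)).re :=
    ((integrable_bcf_mul_re W.χ' h h).add (integrable_bcf_mul_re W.χ g h)).add
    (integrable_bcf_mul_re W.χ h g)
  have hpt : ∀ᵐ x, (g x * conj (h x)).re = (lam x).re * ‖h x‖ ^ 2 + (F x * conj (h x)).re ∧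
      (h x * conj (g x)).re = (lam x).re * ‖h x‖ ^ 2 + (F x * conj (h x)).re := by
    filter_upwards [hg] with x hx
    have h1 : (g x * conj (h x)).re = (lam x).re * ‖h x‖ ^ 2 + (F x * conj (h x)).re := by
      rw [hx, add_mul, Complex.add_re, mul_assoc, Complex.mul_conj, Complex.re_mul_ofReal,
        Complex.normSq_eq_norm_sq]
    refine ⟨h1, ?_⟩
    rw [← h1, ← Complex.conj_re]
    congr 1
    rw [map_mul, Complex.conj_conj, mul_comm]
  have hmain : ∫ x, (δ * (W.χ x * ‖h x‖ ^ 2) - 2 / δ * (W.χ x * ‖F x‖ ^ 2)) ≤ 0 := by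
    rcases hlam with hlam | hlam
    -- Growing case: the `χ'` term has the favourable sign and is dropped, so no smallness of `ε` is
    -- needed.
    · rw [← ibp]
      refine integral_mono_ae (((integrable_energy _ _).const_mul _).sub
        ((integrable_energy _ _).const_mul _)) hint ?_
      filter_upwards [hpt] with x hx
      rw [hx.1, hx.2, re_mul_conj_self]
      have h1 := W.nonneg x
      have h2 := mul_nonneg (W.deriv_nonneg x) (sq_nonneg ‖h x‖)
      have h3 := abs_le.1 (abs_re_mul_conj_le (F x) (h x))
      have h4 : (lam x).re * ‖h x‖ ^ 2 ≥ δ * ‖h x‖ ^ 2 :=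
        mul_le_mul_of_nonneg_right (hlam x) (sq_nonneg _)
      have h5 : 2 * (‖F x‖ * ‖h x‖) ≤ δ * ‖h x‖ ^ 2 + 2 / δ * ‖F x‖ ^ 2 := by
        have e : δ * ‖h x‖ ^ 2 + 2 / δ * ‖F x‖ ^ 2 - 2 * (‖F x‖ * ‖h x‖) =
          (δ * ‖h x‖ - ‖F x‖) ^ 2 / δ + ‖F x‖ ^ 2 / δ := by field_simp; ring
        have : 0 ≤ (δ * ‖h x‖ - ‖F x‖) ^ 2 / δ + ‖F x‖ ^ 2 / δ := by positivity
        linarith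
      nlinarith [mul_le_mul_of_nonneg_left (show δ * ‖h x‖ ^ 2 - 2 / δ * ‖F x‖ ^ 2 ≤
        2 * ((lam x).re * ‖h x‖ ^ 2 + (F x * conj (h x)).re) by linarith) h1]
    -- Decaying case: the `χ'` term has the wrong sign, but `χ' ≤ 2εχ ≤ (δ/2)χ`. The coefficient
    -- contributes `2δ`; `δ/2` goes to `χ'`, `δ/2` to the forcing, and `δ` remains.
    · rw [← neg_zero, ← ibp, ← integral_neg]
      refine integral_mono_ae (((integrable_energy _ _).const_mul _).sub
        ((integrable_energy _ _).const_mul _)) hint.neg ?_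
      filter_upwards [hpt] with x hx
      rw [hx.1, hx.2, re_mul_conj_self]
      have h1 := W.nonneg x
      have h2 := mul_le_mul_of_nonneg_right (W.deriv_le x) (sq_nonneg ‖h x‖)
      have h2' : W.χ x * (2 * ε * ‖h x‖ ^ 2) ≤ W.χ x * (δ / 2 * ‖h x‖ ^ 2) := by
        gcongr
        linarith
      have h3 := abs_le.1 (abs_re_mul_conj_le (F x) (h x))
      have h4 : (lam x).re * ‖h x‖ ^ 2 ≤ -δ * ‖h x‖ ^ 2 :=
        mul_le_mul_of_nonneg_right (hlam x) (sq_nonneg _)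
      have h5 : 2 * (‖F x‖ * ‖h x‖) ≤ δ / 2 * ‖h x‖ ^ 2 + 2 / δ * ‖F x‖ ^ 2 := by
        have e : δ / 2 * ‖h x‖ ^ 2 + 2 / δ * ‖F x‖ ^ 2 - 2 * (‖F x‖ * ‖h x‖) =
          (δ * ‖h x‖ - 2 * ‖F x‖) ^ 2 / (2 * δ) := by field_simp; ring
        have : 0 ≤ (δ * ‖h x‖ - 2 * ‖F x‖) ^ 2 / (2 * δ) := by positivity
        linarith
      nlinarith [mul_le_mul_of_nonneg_left (show δ * ‖h x‖ ^ 2 - 2 / δ * ‖F x‖ ^ 2 ≤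
        -(δ / 2 * ‖h x‖ ^ 2) - 2 * ((lam x).re * ‖h x‖ ^ 2 + (F x * conj (h x)).re)
          by linarith) h1]
  rw [integral_sub ((integrable_energy _ _).const_mul _) ((integrable_energy _ _).const_mul _),
    integral_const_mul, integral_const_mul] at hmain
  change δ * energy W.χ h - 2 / δ * energy W.χ F ≤ 0 at hmain
  have := mul_le_mul_of_nonneg_left hmain hδ.le
  have e : δ * (δ * energy W.χ h - 2 / δ * energy W.χ F) =
    δ ^ 2 * energy W.χ h - 2 * energy W.χ F := by field_simp
  linarith

/-! ### The kink and the nonzero modes -/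

/-- `Q(x) = a tanh (a x)` as a bounded continuous function. -/
def tanhBCF (a : ℝ) : ℝ →ᵇ ℝ :=
  BoundedContinuousFunction.ofNormedAddCommGroup (fun x => a * Real.tanh (a * x))
    (by
      have : Continuous Real.tanh := by
        rw [show Real.tanh = fun x => Real.sinh x / Real.cosh x from
          funext Real.tanh_eq_sinh_div_cosh]
        exact Real.continuous_sinh.div Real.continuous_cosh fun x => (Real.cosh_pos x).ne'
      fun_prop) |a| fun x => by
      rw [norm_mul, Real.norm_eq_abs, Real.norm_eq_abs]
      nlinarith [abs_nonneg a, Real.abs_tanh_lt_one (a * x)]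

@[simp] theorem tanhBCF_apply (a x : ℝ) : tanhBCF a x = a * Real.tanh (a * x) := rfl

/-- `Q' = a² - Q²`. -/
def sechSqBCF (a : ℝ) : ℝ →ᵇ ℝ :=
  BoundedContinuousFunction.const ℝ (a ^ 2) - tanhBCF a * tanhBCF a

theorem sechSqBCF_apply (a x : ℝ) : sechSqBCF a x = a ^ 2 - tanhBCF a x ^ 2 := by
  simp [sechSqBCF, sq]

theorem hasDerivAt_tanh (x : ℝ) : HasDerivAt Real.tanh (1 - Real.tanh x ^ 2) x := by
  rw [show Real.tanh = fun x => Real.sinh x / Real.cosh x from funext Real.tanh_eq_sinh_div_cosh]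
  refine ((Real.hasDerivAt_sinh x).div (Real.hasDerivAt_cosh x) (Real.cosh_pos x).ne').congr_deriv ?_
  have := (Real.cosh_pos x).ne'
  beta_reduce
  rw [div_pow, one_sub_div (pow_ne_zero 2 this)]
  ring

theorem hasDerivAt_tanhBCF (a x : ℝ) : HasDerivAt (tanhBCF a) (sechSqBCF a x) x := by
  have h := ((hasDerivAt_tanh (a * x)).comp x ((hasDerivAt_id x).const_mul a)).const_mul a
  rw [sechSqBCF_apply]
  refine h.congr_deriv ?_
  simp only [tanhBCF_apply]
  ring

theorem tanhBCF_sq_le (a x : ℝ) : tanhBCF a x ^ 2 ≤ a ^ 2 := by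
  have h := Real.abs_tanh_lt_one (a * x)
  have h2 : Real.tanh (a * x) ^ 2 ≤ 1 := by
    rw [← sq_abs]; nlinarith [abs_nonneg (Real.tanh (a * x))]
  rw [tanhBCF_apply]
  nlinarith [sq_nonneg a]

theorem abs_tanhBCF_le {a : ℝ} (ha : 0 < a) (x : ℝ) : |tanhBCF a x| ≤ a :=
  abs_le_of_sq_le_sq (tanhBCF_sq_le a x) ha.le

theorem sechSqBCF_ofReal (a x : ℝ) : (sechSqBCF a x : ℂ) = a ^ 2 - (tanhBCF a x : ℂ) ^ 2 := by
  rw [sechSqBCF_apply]; push_cast; rfl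

/-- First-order factor of the second-order equation satisfied by `v`. -/
def firstOrderFactor (a : ℝ) (ν μ : ℂ) (v w : LineL2) : LineL2 :=
  ν • w + (mulCLM (ofRealBCF (tanhBCF a)) v + μ • v)

theorem coeFn_firstOrderFactor (a : ℝ) (ν μ : ℂ) (v w : LineL2) :
    ∀ᵐ x, firstOrderFactor a ν μ v w x = ν * w x + (tanhBCF a x * v x + μ * v x) := by
  unfold firstOrderFactor
  filter_upwards [Lp.coeFn_add (ν • w) (mulCLM (ofRealBCF (tanhBCF a)) v + μ • v),
    Lp.coeFn_add (mulCLM (ofRealBCF (tanhBCF a)) v) (μ • v), Lp.coeFn_smul ν w,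
    Lp.coeFn_smul μ v, coeFn_mulCLM (ofRealBCF (tanhBCF a)) v] with x h1 h2 h3 h4 h5
  rw [h1, Pi.add_apply, h2, Pi.add_apply, h3, h4, h5]
  rfl

/-- The factor solves `p' = (μ - Q)p - ν f`, and `|Re μ| ≥ a + δ` keeps `Re μ - Q` at distance `δ`
from zero with a constant sign. Assuming only a bound on `|Re μ|` lets the same statement serve for
`μ` and `-μ`. -/
theorem energy_firstOrderFactor_le {a ε δ : ℝ} (ha : 0 < a) (W : SlowWeight ε) (hδ : 0 < δ)
    (hε : ε ≤ δ / 4) {ν μ : ℂ} (hμ : μ ^ 2 = a ^ 2 + ν) (hre : a + δ ≤ |μ.re|)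
    {v w d f : LineL2} (hv : HasL2Deriv v (ν • w)) (hw : HasL2Deriv w d)
    (hf : ∀ᵐ x, f x = -d x + v x - 2 * tanhBCF a x * w x) :
    δ ^ 2 * energy W.χ (firstOrderFactor a ν μ v w) ≤ 2 * (‖ν‖ ^ 2 * energy W.χ f) := by
  have hQ : ∀ x, HasDerivAt (ofRealBCF (tanhBCF a)) (ofRealBCF (sechSqBCF a) x) x :=
    fun x => (hasDerivAt_tanhBCF a x).ofReal_comp
  have H := (hw.const_smul ν).add ((hv.mul hQ).add (hv.const_smul μ))
  have hfl : energy W.χ ((-ν) • f) = ‖ν‖ ^ 2 * energy W.χ f := by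
    rw [energy_const_smul, norm_neg]
  rw [← hfl]
  refine dissipative_estimate W hδ hε H (lam := fun x => μ - tanhBCF a x) ?_ ?_
  · filter_upwards [coeFn_firstOrderFactor a ν μ v w, hf,
      coeFn_firstOrderFactor a ν μ (ν • w) d,
      Lp.coeFn_smul ν w, coeFn_mulCLM (ofRealBCF (sechSqBCF a)) v, Lp.coeFn_smul (-ν) f,
      Lp.coeFn_add (mulCLM (ofRealBCF (sechSqBCF a)) v) (firstOrderFactor a ν μ (ν • w) d)]
      with x h1 h2 h3 h4 h5 h6 h7
    have e : ν • d + ((mulCLM (ofRealBCF (sechSqBCF a)) v +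
        mulCLM (ofRealBCF (tanhBCF a)) (ν • w)) + μ • ν • w) =
        mulCLM (ofRealBCF (sechSqBCF a)) v + firstOrderFactor a ν μ (ν • w) d := by
      unfold firstOrderFactor; abel
    change _ = _ * firstOrderFactor a ν μ v w x + _
    rw [e, h7, Pi.add_apply, h5, h3, h4, h1, h6, Pi.smul_apply, Pi.smul_apply, smul_eq_mul,
      smul_eq_mul, h2, ofRealBCF_apply, sechSqBCF_ofReal]
    -- After `Q' = a² - Q²` only `(a² + ν - μ²)v` is left over, which vanishes by the choice of `μ`.
    linear_combination (-v x) * hμ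
  · have hb := fun x => abs_le.1 (abs_tanhBCF_le ha x)
    rcases le_abs.1 hre with h | h
    · refine Or.inl fun x => ?_
      rw [Complex.sub_re, Complex.ofReal_re]
      linarith [(hb x).2]
    · refine Or.inr fun x => ?_
      rw [Complex.sub_re, Complex.ofReal_re]
      linarith [(hb x).1]

/-- With `p, q` the factors for `μ` and `-μ`, `v = (p - q)/(2μ)` and `w = (p + q - 2Qv)/(2ν)`. The
gap `δ` may depend on the mode; its growth has to be kept in the bound for `v`, where `|ν|²`
appears. -/
theorem energy_mode_le_of_root {a ε δ : ℝ} (ha : 0 < a) (W : SlowWeight ε) (hδ : 0 < δ)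
    (hε : ε ≤ δ / 4) {ν μ : ℂ} (hμ : μ ^ 2 = a ^ 2 + ν) (hre : a + δ ≤ μ.re) (hν : 1 ≤ ‖ν‖)
    {v w d f : LineL2} (hv : HasL2Deriv v (ν • w)) (hw : HasL2Deriv w d)
    (hf : ∀ᵐ x, f x = -d x + v x - 2 * tanhBCF a x * w x) :
    energy W.χ v ≤ 2 * ‖ν‖ ^ 2 / (δ ^ 2 * ‖μ‖ ^ 2) * energy W.χ f ∧
    energy W.χ w ≤ 4 / δ ^ 2 * energy W.χ f + 2 * a ^ 2 * energy W.χ v := by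
  have hμre : a + δ ≤ |μ.re| := hre.trans (le_abs_self _)
  have hμpos : 0 < ‖μ‖ := lt_of_lt_of_le (by linarith) (hμre.trans (Complex.abs_re_le_norm μ))
  have h1 := energy_firstOrderFactor_le ha W hδ hε hμ hμre hv hw hf
  have h2 := energy_firstOrderFactor_le ha W hδ hε (μ := -μ) (by rw [neg_sq, hμ])
    (by rwa [Complex.neg_re, abs_neg]) hv hw hf
  set p := firstOrderFactor a ν μ v w
  set q := firstOrderFactor a ν (-μ) v w
  have hp : ∀ᵐ x, p x = ν * w x + (tanhBCF a x * v x + μ * v x) := coeFn_firstOrderFactor _ _ _ _ _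
  have hq : ∀ᵐ x, q x = ν * w x + (tanhBCF a x * v x + -μ * v x) :=
    coeFn_firstOrderFactor _ _ _ _ _
  have hδ2 : 0 < δ ^ 2 := by positivity
  have h1' : energy W.χ p ≤ 2 * ‖ν‖ ^ 2 / δ ^ 2 * energy W.χ f := by
    rw [div_mul_eq_mul_div, le_div_iff₀ hδ2]; linarith
  have h2' : energy W.χ q ≤ 2 * ‖ν‖ ^ 2 / δ ^ 2 * energy W.χ f := by
    rw [div_mul_eq_mul_div, le_div_iff₀ hδ2]; linarith
  constructor
  · have hb : energy W.χ v ≤ 1 / (2 * ‖μ‖ ^ 2) * energy W.χ p + 1 / (2 * ‖μ‖ ^ 2) * energy W.χ q := by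
      refine energy_le W.nonneg ?_
      filter_upwards [hp, hq] with x hx hy
      have h3 := norm_sub_sq_le (p x) (q x)
      have h4 : p x - q x = 2 * μ * v x := by rw [hx, hy]; ring
      rw [h4, norm_mul, norm_mul, RCLike.norm_ofNat] at h3
      rw [← mul_add, one_div, inv_mul_eq_div, le_div_iff₀ (by positivity)]
      nlinarith
    have e : 2 * ‖ν‖ ^ 2 / (δ ^ 2 * ‖μ‖ ^ 2) * energy W.χ f =
      1 / (2 * ‖μ‖ ^ 2) * (2 * ‖ν‖ ^ 2 / δ ^ 2 * energy W.χ f) +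
      1 / (2 * ‖μ‖ ^ 2) * (2 * ‖ν‖ ^ 2 / δ ^ 2 * energy W.χ f) := by field_simp; ring
    rw [e]
    exact hb.trans (by gcongr)
  · have hν0 : 0 < ‖ν‖ := by linarith
    let r := p + q
    have hr : energy W.χ r ≤ 2 * energy W.χ p + 2 * energy W.χ q := by
      refine energy_le W.nonneg ?_
      filter_upwards [Lp.coeFn_add p q] with x hx
      rw [hx]; exact norm_add_sq_le _ _
    have hb : energy W.χ w ≤ 1 / (2 * ‖ν‖ ^ 2) * energy W.χ r + 2 * a ^ 2 * energy W.χ v := by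
      refine energy_le W.nonneg ?_
      filter_upwards [hp, hq, Lp.coeFn_add p q] with x hx hy hz
      have h4 : 2 * ν * w x = r x - 2 * tanhBCF a x * v x := by
        rw [hz, Pi.add_apply, hx, hy]; ring
      have h3 := norm_sub_sq_le (r x) (2 * tanhBCF a x * v x)
      rw [← h4] at h3
      simp only [norm_mul, RCLike.norm_ofNat, Complex.norm_real, Real.norm_eq_abs, mul_pow,
        sq_abs] at h3
      -- `|ν| ≥ 1` is used to drop the division by `ν` in the term `Qv/ν`.
      have h5 : 1 ≤ ‖ν‖ ^ 2 := by nlinarith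
      have h6 := tanhBCF_sq_le a x
      have h7 : tanhBCF a x ^ 2 * ‖v x‖ ^ 2 ≤ a ^ 2 * ‖ν‖ ^ 2 * ‖v x‖ ^ 2 := by
        gcongr
        nlinarith [sq_nonneg a]
      have e : 1 / (2 * ‖ν‖ ^ 2) * ‖r x‖ ^ 2 + 2 * a ^ 2 * ‖v x‖ ^ 2 =
        (‖r x‖ ^ 2 + 4 * (a ^ 2 * ‖ν‖ ^ 2 * ‖v x‖ ^ 2)) / (2 * ‖ν‖ ^ 2) := by field_simp; ring
      rw [e, le_div_iff₀ (by positivity)]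
      nlinarith
    have e : 4 / δ ^ 2 * energy W.χ f = 1 / (2 * ‖ν‖ ^ 2) *
      (2 * (2 * ‖ν‖ ^ 2 / δ ^ 2 * energy W.χ f) + 2 * (2 * ‖ν‖ ^ 2 / δ ^ 2 * energy W.χ f)) := by
      field_simp; ring
    rw [e]
    refine hb.trans ?_
    gcongr
    linarith

/-- A square root of `a² + in` with real part beyond `a`, uniformly in `n ≠ 0`. -/
theorem exists_root {a : ℝ} (ha : 0 < a) :
    ∃ δ : ℝ, 0 < δ ∧ ∃ K : ℝ, 0 < K ∧ ∀ n : ℤ, n ≠ 0 → ∃ μ : ℂ, ∃ δn : ℝ, δ ≤ δn ∧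
      μ ^ 2 = a ^ 2 + Complex.I * n ∧ a + δn ≤ μ.re ∧ (n : ℝ) ^ 2 ≤ K * (δn ^ 2 * ‖μ‖ ^ 2) := by
  set S := 1 + 4 * a ^ 2 * (1 + a ^ 2) with hS
  have hSpos : 0 < S := by positivity
  set b := 1 / (1 + a ^ 2) with hb
  have hbpos : 0 < b := by positivity
  -- With `μ = α + iβ`, the relations `α² - β² = a²`, `2αβ = n` give `β² ≥ b/4`, then `α² ≤ Sβ²` and
  -- `β² ≤ 4S(α - a)²`. Hence the gap satisfies `(α - a)² ≥ b/(16S)`, and `n² = 4α²β² ≤ 16S(α -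
  -- a)²|μ|²`.
  refine ⟨√(b / (16 * S)), by positivity, 16 * S, by positivity, fun n hn => ?_⟩
  obtain ⟨μ₀, hμ₀⟩ := IsAlgClosed.exists_pow_nat_eq (a ^ 2 + Complex.I * n : ℂ) two_pos
  obtain ⟨μ, hμ, hμre⟩ : ∃ μ : ℂ, μ ^ 2 = a ^ 2 + Complex.I * n ∧ 0 ≤ μ.re := by
    rcases le_total 0 μ₀.re with h | h
    · exact ⟨μ₀, hμ₀, h⟩
    · exact ⟨-μ₀, by rw [neg_sq, hμ₀], by rw [Complex.neg_re]; linarith⟩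
  set α := μ.re
  set β := μ.im
  have hre : α ^ 2 - β ^ 2 = a ^ 2 := by
    have := congrArg Complex.re hμ
    simp [sq] at this
    simp only [α, β, sq]; linarith
  have him : 2 * α * β = n := by
    have := congrArg Complex.im hμ
    simp [sq] at this
    simp only [α, β]; linarith
  have hn1 : (1 : ℝ) ≤ (n : ℝ) ^ 2 := by
    have : (1 : ℤ) ≤ n ^ 2 := by
      have := Int.one_le_abs hn
      rw [← sq_abs]; nlinarith
    exact_mod_cast this
  have hαa : a ≤ α := abs_le_of_sq_le_sq' (by nlinarith [sq_nonneg β]) hμre |>.2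
  have hαpos : 0 < α := lt_of_lt_of_le ha hαa
  have hββ : 1 ≤ 4 * (β ^ 2 * (β ^ 2 + a ^ 2)) := by
    have : (n : ℝ) ^ 2 = 4 * (β ^ 2 * (β ^ 2 + a ^ 2)) := by
      rw [← him, ← hre]; ring
    linarith
  have hβb : b / 4 ≤ β ^ 2 := by
    by_contra hlt
    push Not at hlt
    have h1 : b ≤ 1 := by
      rw [hb, div_le_one (by positivity)]; nlinarith [sq_nonneg a]
    have h2 : b * (1 + a ^ 2) = 1 := by rw [hb]; field_simp
    nlinarith [sq_nonneg β, sq_nonneg a]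
  have hβpos : 0 < β ^ 2 := by linarith [div_pos hbpos (by norm_num : (0 : ℝ) < 4)]
  have hαS : α ^ 2 ≤ S * β ^ 2 := by
    have h2 : b * (1 + a ^ 2) = 1 := by rw [hb]; field_simp
    have h3 : 1 ≤ 4 * (1 + a ^ 2) * β ^ 2 := by
      rw [← h2]; nlinarith [sq_nonneg a]
    have h4 := mul_le_mul_of_nonneg_left h3 (sq_nonneg a)
    rw [hS]
    nlinarith
  have hfac : (α - a) * (α + a) = β ^ 2 := by linarith
  -- Square `(α - a)(α + a) = β²`, use `α + a ≤ 2α` and `α² ≤ Sβ²`, then cancel one factor `β²`.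
  have hδ : β ^ 2 ≤ 4 * S * (α - a) ^ 2 := by
    have h5 : (α + a) ^ 2 ≤ 4 * (S * β ^ 2) := by nlinarith
    have h6 : (β ^ 2) ^ 2 ≤ (α - a) ^ 2 * (4 * (S * β ^ 2)) := by
      rw [← hfac, mul_pow, hfac]
      exact mul_le_mul_of_nonneg_left h5 (sq_nonneg _)
    have h7 : β ^ 2 * β ^ 2 ≤ (4 * S * (α - a) ^ 2) * β ^ 2 := by nlinarith
    exact le_of_mul_le_mul_right h7 hβpos
  refine ⟨μ, α - a, ?_, hμ, by linarith, ?_⟩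
  · refine Real.sqrt_le_iff.2 ⟨by linarith, ?_⟩
    rw [div_le_iff₀ (by positivity)]
    linarith
  · have hnorm : α ^ 2 ≤ ‖μ‖ ^ 2 := by
      rw [← Complex.normSq_eq_norm_sq, Complex.normSq_apply]
      nlinarith [sq_nonneg β]
    rw [← him]
    have h8 := mul_le_mul hδ hnorm (sq_nonneg α) (by positivity)
    nlinarith

/-- The weighted estimate for a nonzero Fourier mode. -/
theorem nonzero_mode_estimate {a : ℝ} (ha : 0 < a) :
    ∃ ε₀ : ℝ, 0 < ε₀ ∧ ∃ K : ℝ, 0 < K ∧ ∀ ε ≤ ε₀, ∀ W : SlowWeight ε, ∀ n : ℤ, n ≠ 0 →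
      ∀ v w d f : LineL2, HasL2Deriv v ((Complex.I * n) • w) → HasL2Deriv w d →
      (∀ᵐ x, f x = -d x + v x - 2 * tanhBCF a x * w x) →
      energy W.χ v ≤ K * energy W.χ f ∧ energy W.χ w ≤ K * energy W.χ f := by
  obtain ⟨δ, hδ, K, hK, h⟩ := exists_root ha
  refine ⟨δ / 4, by positivity, 2 * K + (4 / δ ^ 2 + 2 * a ^ 2 * (2 * K)), by positivity,
    fun ε hε W n hn v w d f hv hw hf => ?_⟩
  obtain ⟨μ, δn, hδn, hμ, hre, hn2⟩ := h n hn
  have hδn0 : 0 < δn := hδ.trans_le hδn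
  have hν : ‖Complex.I * n‖ = |(n : ℝ)| := by simp
  have hn1 : (1 : ℝ) ≤ |(n : ℝ)| := by exact_mod_cast Int.one_le_abs hn
  obtain ⟨h1, h2⟩ := energy_mode_le_of_root ha W hδn0 (by linarith) hμ hre (by rwa [hν]) hv hw hf
  have hE := energy_nonneg W.nonneg f
  have hμpos : 0 < ‖μ‖ := by
    have := Complex.abs_re_le_norm μ
    have := le_abs_self μ.re
    linarith
  -- Uniformity in `n`: `|ν|² = n²` is absorbed by `δn²|μ|²`.
  have h3 : energy W.χ v ≤ 2 * K * energy W.χ f := by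
    refine h1.trans (mul_le_mul_of_nonneg_right ?_ hE)
    rw [hν, sq_abs, div_le_iff₀ (by positivity)]
    linarith
  have h4 : 4 / δn ^ 2 * energy W.χ f ≤ 4 / δ ^ 2 * energy W.χ f := by gcongr
  have h5 : 2 * a ^ 2 * energy W.χ v ≤ 2 * a ^ 2 * (2 * K * energy W.χ f) := by gcongr
  have h6 : 0 ≤ 2 * K * energy W.χ f := by positivity
  have h7 : 0 ≤ 4 / δ ^ 2 * energy W.χ f := by positivity
  have h8 : 0 ≤ 2 * a ^ 2 * (2 * K * energy W.χ f) := by positivity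
  constructor <;> linarith

/-! ### The zero mode and the range of the adjoint `∂ - 2Q` -/

theorem sechSqBCF_pos {a : ℝ} (ha : 0 < a) (x : ℝ) : 0 < sechSqBCF a x := by
  have h := Real.abs_tanh_lt_one (a * x)
  have h2 : Real.tanh (a * x) ^ 2 < 1 := by
    rw [← sq_abs]; nlinarith [abs_nonneg (Real.tanh (a * x))]
  rw [sechSqBCF_apply, tanhBCF_apply]
  nlinarith [pow_pos ha 2]

theorem sechSqBCF_le (a x : ℝ) : sechSqBCF a x ≤ a ^ 2 := by
  rw [sechSqBCF_apply]; linarith [sq_nonneg (tanhBCF a x)]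

theorem one_add_sq_le_cosh_sq (t : ℝ) : (1 + t ^ 2) / 2 ≤ Real.cosh t ^ 2 := by
  have h1 := Real.quadratic_le_exp_of_nonneg (abs_nonneg t)
  have h2 := Real.add_one_le_exp (-|t|)
  have h3 : 1 + t ^ 2 / 4 ≤ Real.cosh t := by
    rw [← Real.cosh_abs, Real.cosh_eq, ← sq_abs t]; linarith
  nlinarith [sq_nonneg t, sq_nonneg (t ^ 2)]

/-- Since `Q' = a² / cosh²(ax)`, a quadratic lower bound on `cosh²` suffices; this crude decay is
all that is needed for `Q' ∈ L²`. -/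
theorem sechSqBCF_decay {a : ℝ} (x : ℝ) : sechSqBCF a x ≤ 2 * a ^ 2 * (1 + (a * x) ^ 2)⁻¹ := by
  have hc := (Real.cosh_pos (a * x))
  have h1 : sechSqBCF a x = a ^ 2 * (Real.cosh (a * x) ^ 2)⁻¹ := by
    rw [sechSqBCF_apply, tanhBCF_apply, Real.tanh_eq_sinh_div_cosh]
    have := Real.cosh_sq (a * x)
    field_simp
    rw [this]; ring
  have e : 2 * a ^ 2 * (1 + (a * x) ^ 2)⁻¹ = a ^ 2 * ((1 + (a * x) ^ 2) / 2)⁻¹ := by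
    field_simp
  rw [h1, e]
  have h2 := one_add_sq_le_cosh_sq (a * x)
  gcongr

theorem memLp_sechSq {a : ℝ} (ha : 0 < a) :
    MemLp (fun x => (sechSqBCF a x : ℂ)) 2 (volume : Measure ℝ) := by
  rw [memLp_two_iff_integrable_sq_norm
    (f := fun x => (sechSqBCF a x : ℂ))
    (Complex.continuous_ofReal.comp (sechSqBCF a).continuous).aestronglyMeasurable]
  have hi : Integrable fun x : ℝ => a ^ 2 * (2 * a ^ 2 * (1 + (a * x) ^ 2)⁻¹) :=
    (((integrable_inv_one_add_sq).comp_mul_left' ha.ne').const_mul _).const_mul _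
  refine hi.mono' (by
    have := (sechSqBCF a).continuous
    exact (by fun_prop : Continuous fun x => ‖(sechSqBCF a x : ℂ)‖ ^ 2).aestronglyMeasurable) ?_
  refine ae_of_all _ fun x => ?_
  have h1 := sechSqBCF_le a x
  have h2 := sechSqBCF_decay (a := a) x
  have h3 := (sechSqBCF_pos ha x)
  rw [Complex.norm_real, Real.norm_eq_abs, Real.norm_eq_abs, abs_of_pos h3, sq,
    abs_of_pos (mul_pos h3 h3)]
  exact mul_le_mul h1 h2 h3.le (sq_nonneg a)

/-- `Q'` as an element of `L²(ℝ)`. -/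
def sechSqLp {a : ℝ} (ha : 0 < a) : LineL2 := (memLp_sechSq ha).toLp _

theorem inner_sechSqLp {a : ℝ} (ha : 0 < a) (h : LineL2) :
    inner ℂ (sechSqLp ha) h = ∫ x, (sechSqBCF a x : ℂ) * h x := by
  rw [inner_eq_integral]
  refine integral_congr_ae ?_
  filter_upwards [(memLp_sechSq ha).coeFn_toLp] with x hx
  change h x * conj ((memLp_sechSq ha).toLp _ x) = _
  rw [hx, Complex.conj_ofReal, mul_comm]

/-- The coercive pairing of `∂ - 2Q` with itself. -/
theorem norm_sq_le_of_hasL2Deriv {a : ℝ} {u g r : LineL2} (H : HasL2Deriv u g)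
    (hr : ∀ᵐ x, r x = g x - 2 * tanhBCF a x * u x) :
    ‖g‖ ^ 2 + 2 * a ^ 2 * ‖u‖ ^ 2 ≤ ‖r‖ ^ 2 := by
  have ibp := H.weighted (hasDerivAt_tanhBCF a) H
  have hone : ∀ h : LineL2, energy 1 h = ‖h‖ ^ 2 := fun h => by
    have := @inner_self_eq_norm_sq ℂ LineL2 _ _ _ h
    rw [← this, RCLike.re_eq_complex_re, inner_eq_integral, ← RCLike.re_eq_complex_re,
      ← integral_re (integrable_mul_conj _ _)]
    unfold energy
    refine integral_congr_ae (ae_of_all _ fun x => ?_)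
    beta_reduce
    rw [RCLike.re_eq_complex_re, re_mul_conj_self]
    simp
  rw [← hone, ← hone, ← hone]
  have hint : Integrable fun x => sechSqBCF a x * (u x * conj (u x)).re +
      tanhBCF a x * (g x * conj (u x)).re + tanhBCF a x * (u x * conj (g x)).re :=
    ((integrable_bcf_mul_re _ u u).add (integrable_bcf_mul_re _ g u)).add
    (integrable_bcf_mul_re _ u g)
  -- Subtracting twice the vanishing integral of `(Q|u|²)'` trades the cross term of `|g - 2Qu|²`
  -- for `2Q'|u|²`. Pointwise, `2Q' + 4Q² = 2a² + 2Q² ≥ 2a²`.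
  have e : energy 1 g + 2 * a ^ 2 * energy 1 u =
      ∫ x, ((1 : ℝ →ᵇ ℝ) x * ‖g x‖ ^ 2 + 2 * a ^ 2 * ((1 : ℝ →ᵇ ℝ) x * ‖u x‖ ^ 2) - 2 *
        (sechSqBCF a x * (u x * conj (u x)).re +
      tanhBCF a x * (g x * conj (u x)).re + tanhBCF a x * (u x * conj (g x)).re)) := by
    have hi : Integrable fun x => (1 : ℝ →ᵇ ℝ) x * ‖g x‖ ^ 2 +
        2 * a ^ 2 * ((1 : ℝ →ᵇ ℝ) x * ‖u x‖ ^ 2) :=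
      (integrable_energy 1 g).add ((integrable_energy 1 u).const_mul _)
    rw [integral_sub hi
      (hint.const_mul 2), integral_const_mul, ibp, integral_add (integrable_energy 1 g)
      ((integrable_energy 1 u).const_mul _), integral_const_mul]
    simp [energy]
  rw [e]
  refine integral_mono_ae (((integrable_energy 1 g).add ((integrable_energy 1 u).const_mul _)).sub
      (hint.const_mul 2)) (integrable_energy 1 r) ?_
  filter_upwards [hr] with x hx
  have h1 : ‖r x‖ ^ 2 = ‖g x‖ ^ 2 - 4 * (tanhBCF a x * (g x * conj (u x)).re)
      + 4 * tanhBCF a x ^ 2 * ‖u x‖ ^ 2 := by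
    rw [hx, ← Complex.normSq_eq_norm_sq, Complex.normSq_sub, Complex.normSq_eq_norm_sq,
      Complex.normSq_eq_norm_sq, norm_mul, norm_mul, RCLike.norm_ofNat, Complex.norm_real,
      Real.norm_eq_abs, mul_pow, mul_pow, sq_abs]
    have : (g x * conj (2 * (tanhBCF a x : ℂ) * u x)).re = 2 * (tanhBCF a x * (g x * conj (u x)).re) := by
      rw [map_mul, map_mul, Complex.conj_ofReal, Complex.conj_ofNat,
        show g x * (2 * (tanhBCF a x : ℂ) * conj (u x)) =
          ((2 * tanhBCF a x : ℝ) : ℂ) * (g x * conj (u x)) by push_cast; ring,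
        Complex.re_ofReal_mul]
      ring
    rw [this]; ring
  have h2 : (u x * conj (g x)).re = (g x * conj (u x)).re := by
    rw [← Complex.conj_re, map_mul, Complex.conj_conj, mul_comm]
  have h3 := sechSqBCF_apply a x
  simp only [BoundedContinuousFunction.coe_one, Pi.one_apply, one_mul]
  rw [h1, h2, re_mul_conj_self, h3]
  nlinarith [mul_nonneg (sq_nonneg (tanhBCF a x)) (sq_nonneg ‖u x‖)]

/-- The operator `(u, u') ↦ u' - 2Qu`. -/
def adjointOp (a : ℝ) : smoothPairs.topologicalClosure →L[ℂ] LineL2 :=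
  (ContinuousLinearMap.snd ℂ LineL2 LineL2 -
    (2 : ℂ) • (mulCLM (ofRealBCF (tanhBCF a))).comp (ContinuousLinearMap.fst ℂ LineL2 LineL2)).comp
    smoothPairs.topologicalClosure.subtypeL

theorem coeFn_adjointOp (a : ℝ) (p : smoothPairs.topologicalClosure) :
    ∀ᵐ x, adjointOp a p x = p.1.2 x - 2 * tanhBCF a x * p.1.1 x := by
  have e : adjointOp a p = p.1.2 - (2 : ℂ) • mulCLM (ofRealBCF (tanhBCF a)) p.1.1 := rfl
  rw [e]
  filter_upwards [Lp.coeFn_sub p.1.2 ((2 : ℂ) • mulCLM (ofRealBCF (tanhBCF a)) p.1.1),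
    Lp.coeFn_smul (2 : ℂ) (mulCLM (ofRealBCF (tanhBCF a)) p.1.1),
    coeFn_mulCLM (ofRealBCF (tanhBCF a)) p.1.1] with x h1 h2 h3
  rw [h1, Pi.sub_apply, h2, Pi.smul_apply, h3, smul_eq_mul, ofRealBCF_apply, mul_assoc]

/-- The coercive pairing bounds the operator below in the graph norm, and its domain, a closed
subspace, is complete. -/
theorem isClosed_range_adjointOp {a : ℝ} (ha : 0 < a) : IsClosed (Set.range (adjointOp a)) := by
  have hcomp : CompleteSpace smoothPairs.topologicalClosure :=
    (Submodule.isClosed_topologicalClosure _).completeSpace_coe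
  set c : ℝ := 1 + 1 / a with hc
  have hanti : AntilipschitzWith (Real.toNNReal c) (adjointOp a) := by
    refine AddMonoidHomClass.antilipschitz_of_bound _ fun p => ?_
    have h := norm_sq_le_of_hasL2Deriv (a := a) p.2 (coeFn_adjointOp a p)
    rw [Real.coe_toNNReal _ (by positivity)]
    have h0 := norm_nonneg (adjointOp a p)
    change max ‖p.1.1‖ ‖p.1.2‖ ≤ _
    have hg : ‖p.1.2‖ ≤ ‖adjointOp a p‖ := by
      refine abs_le_of_sq_le_sq' ?_ h0 |>.2
      nlinarith [sq_nonneg (a * ‖p.1.1‖)]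
    have hu : a * ‖p.1.1‖ ≤ ‖adjointOp a p‖ := by
      refine abs_le_of_sq_le_sq' ?_ h0 |>.2
      nlinarith [sq_nonneg (a * ‖p.1.1‖), sq_nonneg ‖p.1.2‖]
    have hu' : ‖p.1.1‖ ≤ 1 / a * ‖adjointOp a p‖ := by
      rw [one_div, inv_mul_eq_div, le_div_iff₀ ha]; linarith
    have h1 : 0 ≤ 1 / a * ‖adjointOp a p‖ := by positivity
    rw [hc, add_mul, one_mul]
    exact max_le (by linarith) (by linarith)
  exact hanti.isClosed_range (adjointOp a).uniformContinuous

/-- `Q'` is an integrating factor: `Q'' = -2QQ'` turns `u' - 2Qu = η` into `(Q'u)' = Q'η`. The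
solution starting from zero on the left vanishes again on the right exactly because `∫ Q'η = 0`, so
it has compact support although `1/Q'` grows. -/
theorem mem_range_adjointOp_of_continuous {a : ℝ} (ha : 0 < a) {η : ℝ → ℂ} (hη : Continuous η)
    (hs : HasCompactSupport η) (h0 : ∫ x, (sechSqBCF a x : ℂ) * η x = 0) {w : LineL2}
    (hw : w =ᵐ[volume] η) : w ∈ Set.range (adjointOp a) := by
  obtain ⟨R, hR⟩ : ∃ R : ℝ, Function.support η ⊆ Set.Ioc (-R) R := by
    obtain ⟨R, hR⟩ := hs.isCompact.isBounded.subset_closedBall (0 : ℝ)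
    -- The margin puts the support inside a half-open interval, the kind over which interval
    -- integrals are taken.
    refine ⟨R + 1, fun x hx => ?_⟩
    have := hR (subset_tsupport _ hx)
    rw [Metric.mem_closedBall, dist_zero_right, Real.norm_eq_abs, abs_le] at this
    exact ⟨by linarith, by linarith⟩
  set F : ℝ → ℂ := fun x => (sechSqBCF a x : ℂ) * η x
  have hF : Continuous F := (Complex.continuous_ofReal.comp (sechSqBCF a).continuous).mul hη
  have hFs : Function.support F ⊆ Set.Ioc (-R) R := fun x hx => hR (right_ne_zero_of_mul hx)
  set V : ℝ → ℂ := fun x => ∫ t in (-R)..x, F t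
  have hV : ∀ x, HasDerivAt V (F x) x := fun x => (hF.integral_hasStrictDerivAt (-R) x).hasDerivAt
  have hV0 : ∀ x, x ∉ Set.Icc (-R) R → V x = 0 := by
    intro x hx
    rcases lt_or_ge x (-R) with h | h
    · refine intervalIntegral.integral_zero_ae (ae_of_all _ fun t ht => ?_)
      rw [Set.uIoc_of_ge h.le] at ht
      by_contra hne
      exact absurd (hFs hne).1 (not_lt.2 ht.2)
    · have hx' : R < x := by
        by_contra hle
        exact hx ⟨h, not_lt.1 hle⟩
      change ∫ t in (-R)..x, F t = 0
      rw [intervalIntegral.integral_eq_integral_of_support_subset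
        (hFs.trans (Set.Ioc_subset_Ioc_right hx'.le)), h0]
  have hQne : ∀ x, (sechSqBCF a x : ℂ) ≠ 0 := fun x =>
    Complex.ofReal_ne_zero.2 (sechSqBCF_pos ha x).ne'
  have hQ' : ∀ x, HasDerivAt (fun x => (sechSqBCF a x : ℂ))
      ((-2 * tanhBCF a x * sechSqBCF a x : ℝ) : ℂ) x := by
    intro x
    refine HasDerivAt.ofReal_comp ?_
    have h := ((hasDerivAt_tanhBCF a x).pow 2).const_sub (a ^ 2)
    refine (h.congr_of_eventuallyEq (Eventually.of_forall fun y => ?_)).congr_deriv ?_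
    · rw [sechSqBCF_apply]; rfl
    · push_cast; ring
  set U : ℝ → ℂ := fun x => V x / sechSqBCF a x
  set U' : ℝ → ℂ := fun x => η x + 2 * tanhBCF a x * U x
  have hU : ∀ x, HasDerivAt U (U' x) x := by
    intro x
    refine ((hV x).div (hQ' x) (hQne x)).congr_deriv ?_
    have := hQne x
    simp only [F, U', U]
    field_simp
    push_cast
    ring
  have hU0 : ∀ x, x ∉ Set.Icc (-R) R → U x = 0 := fun x hx => by
    simp only [U]; rw [hV0 x hx, zero_div]
  have hUc : Continuous U := continuous_iff_continuousAt.2 fun x => (hU x).continuousAt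
  have hU'c : Continuous U' := hη.add ((continuous_const.mul
    (Complex.continuous_ofReal.comp (tanhBCF a).continuous)).mul hUc)
  have hUm : MemLp U 2 (volume : Measure ℝ) :=
    hUc.memLp_of_hasCompactSupport (HasCompactSupport.intro isCompact_Icc hU0)
  have hU'm : MemLp U' 2 (volume : Measure ℝ) := by
    refine hU'c.memLp_of_hasCompactSupport
      (HasCompactSupport.intro (isCompact_Icc (a := -R) (b := R)) fun x hx => ?_)
    have hηx : η x = 0 := by
      by_contra hne
      exact hx (Set.Ioc_subset_Icc_self (hR hne))
    simp only [U', hU0 x hx, hηx, mul_zero, add_zero]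
  refine ⟨⟨(hUm.toLp, hU'm.toLp), subset_closure ⟨U, U', hU, hUm.coeFn_toLp, hU'm.coeFn_toLp⟩⟩, ?_⟩
  ext1
  filter_upwards [coeFn_adjointOp a ⟨(hUm.toLp, hU'm.toLp),
    subset_closure ⟨U, U', hU, hUm.coeFn_toLp, hU'm.coeFn_toLp⟩⟩, hw, hUm.coeFn_toLp,
    hU'm.coeFn_toLp] with x h1 h2 h3 h4
  rw [h1, h2, h3, h4]
  simp only [U']
  ring

/-- The range is closed, so it is enough to approximate `w` by compactly supported functions that
are still orthogonal to `Q'`. -/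
theorem mem_range_adjointOp {a : ℝ} (ha : 0 < a) {w : LineL2}
    (h0 : ∫ x, (sechSqBCF a x : ℂ) * w x = 0) : w ∈ Set.range (adjointOp a) := by
  set D : Set LineL2 :=
    {f | ∃ g : ℝ → ℂ, f =ᵐ[volume] g ∧ HasCompactSupport g ∧ ContDiff ℝ (⊤ : ℕ∞) g}
  have hD : Dense D := Lp.dense_hasCompactSupport_contDiff (by norm_num)
  -- Correcting along `Q'` itself would destroy compact support, so the projection `P` removes the
  -- `Q'` component along a test function `ρ₀`. It is continuous and fixes `w`.
  obtain ⟨ρ₀, hρ₀, hρne⟩ : ∃ ρ₀ ∈ D, inner ℂ (sechSqLp ha) ρ₀ ≠ 0 := by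
    by_contra hcon
    push Not at hcon
    have hcl : IsClosed {f : LineL2 | inner ℂ (sechSqLp ha) f = 0} :=
      isClosed_eq (by fun_prop) continuous_const
    have hmem : sechSqLp ha ∈ {f : LineL2 | inner ℂ (sechSqLp ha) f = 0} :=
      closure_minimal hcon hcl (hD _)
    have hz : sechSqLp ha = 0 := inner_self_eq_zero.1 hmem
    have hae : ∀ᵐ x : ℝ, False := by
      filter_upwards [(memLp_sechSq ha).coeFn_toLp, Lp.coeFn_zero ℂ 2 (volume : Measure ℝ)]
        with x h1 h2
      change sechSqLp ha x = _ at h1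
      rw [hz, h2, Pi.zero_apply] at h1
      exact (sechSqBCF_pos ha x).ne (Complex.ofReal_injective (by simpa using h1))
    rw [ae_iff] at hae
    simp at hae
  obtain ⟨ρ, hρae, hρs, hρc⟩ := hρ₀
  set c := inner ℂ (sechSqLp ha) ρ₀
  let P : LineL2 → LineL2 := fun f => f - (inner ℂ (sechSqLp ha) f / c) • ρ₀
  have hP : Continuous P := by fun_prop
  have hPw : P w = w := by
    simp only [P]
    rw [inner_sechSqLp, h0, zero_div, zero_smul, sub_zero]
  rw [← (isClosed_range_adjointOp ha).closure_eq, ← hPw]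
  refine map_mem_closure hP (hD w) ?_
  rintro f ⟨η, hη, hηs, hηc⟩
  set k := inner ℂ (sechSqLp ha) f / c with hk
  have hPf : P f =ᵐ[volume] fun x => η x - k * ρ x := by
    filter_upwards [Lp.coeFn_sub f (k • ρ₀), Lp.coeFn_smul k ρ₀, hη, hρae] with x h1 h2 h3 h4
    change (f - k • ρ₀ : LineL2) x = _
    rw [h1, Pi.sub_apply, h2, Pi.smul_apply, h3, h4, smul_eq_mul]
  refine mem_range_adjointOp_of_continuous ha
    (hηc.continuous.sub (continuous_const.mul hρc.continuous))
    (hηs.sub hρs.mul_left) ?_ hPf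
  have h1 : inner ℂ (sechSqLp ha) (P f) = 0 := by
    change inner ℂ (sechSqLp ha) (f - k • ρ₀) = 0
    rw [inner_sub_right, inner_smul_right, hk, div_mul_cancel₀ _ hρne, sub_self]
  rw [inner_sechSqLp] at h1
  rw [← h1]
  refine integral_congr_ae ?_
  filter_upwards [hPf] with x hx
  rw [hx]
  rfl

/-- The weighted estimate for the zeroth Fourier mode. -/
theorem zero_mode_estimate {a : ℝ} (ha : 0 < a) {ε : ℝ} (hε : ε ≤ a / 2)
    (W : SlowWeight ε)
    {w d f : LineL2} (hw : HasL2Deriv w d) (h0 : ∫ x, (sechSqBCF a x : ℂ) * w x = 0)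
    (hf : ∀ᵐ x, f x = -d x - 2 * tanhBCF a x * w x) :
    energy W.χ w ≤ 4 / a ^ 2 * energy W.χ f := by
  obtain ⟨p, hp⟩ := mem_range_adjointOp ha h0
  have hpx := coeFn_adjointOp a p
  rw [hp] at hpx
  obtain ⟨⟨u, g⟩, H⟩ := p
  change HasL2Deriv u g at H
  change ∀ᵐ x, w x = g x - 2 * tanhBCF a x * u x at hpx
  have hQ : ∀ x, HasDerivAt (ofRealBCF (tanhBCF a)) (ofRealBCF (sechSqBCF a) x) x :=
    fun x => (hasDerivAt_tanhBCF a x).ofReal_comp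
  have G := hw.add ((H.mul hQ).const_smul 2)
  -- Elliptic gain: `u' = w + 2Qu` is a sum of `H¹` functions, so `u` has a second derivative `l`.
  have hg : w + (2 : ℂ) • mulCLM (ofRealBCF (tanhBCF a)) u = g := by
    ext1
    filter_upwards [Lp.coeFn_add w ((2 : ℂ) • mulCLM (ofRealBCF (tanhBCF a)) u),
      Lp.coeFn_smul (2 : ℂ) (mulCLM (ofRealBCF (tanhBCF a)) u),
      coeFn_mulCLM (ofRealBCF (tanhBCF a)) u, hpx] with x h1 h2 h3 h4
    rw [h1, Pi.add_apply, h2, Pi.smul_apply, h3, h4, smul_eq_mul, ofRealBCF_apply]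
    ring
  rw [hg] at G
  set l := d + (2 : ℂ) • (mulCLM (ofRealBCF (sechSqBCF a)) u + mulCLM (ofRealBCF (tanhBCF a)) g)
  have hl : ∀ᵐ x, l x = -f x + (2 * a ^ 2 + 2 * tanhBCF a x ^ 2 : ℝ) * u x := by
    filter_upwards [Lp.coeFn_add d ((2 : ℂ) • (mulCLM (ofRealBCF (sechSqBCF a)) u +
        mulCLM (ofRealBCF (tanhBCF a)) g)),
      Lp.coeFn_smul (2 : ℂ) (mulCLM (ofRealBCF (sechSqBCF a)) u +
        mulCLM (ofRealBCF (tanhBCF a)) g),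
      Lp.coeFn_add (mulCLM (ofRealBCF (sechSqBCF a)) u) (mulCLM (ofRealBCF (tanhBCF a)) g),
      coeFn_mulCLM (ofRealBCF (sechSqBCF a)) u, coeFn_mulCLM (ofRealBCF (tanhBCF a)) g, hpx, hf]
      with x h1 h2 h3 h4 h5 h6 h7
    rw [h1, Pi.add_apply, h2, Pi.smul_apply, h3, Pi.add_apply, h4, h5, h7, h6, smul_eq_mul,
      ofRealBCF_apply, ofRealBCF_apply, sechSqBCF_ofReal]
    push_cast
    ring
  have ibp := G.weighted W.hasDerivAt H
  have hint : Integrable fun x => W.χ' x * (g x * conj (u x)).re + W.χ x * (l x * conj (u x)).re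
      + W.χ x * (g x * conj (g x)).re :=
    ((integrable_bcf_mul_re W.χ' g u).add (integrable_bcf_mul_re W.χ l u)).add
    (integrable_bcf_mul_re W.χ g g)
  -- Of `|g|² + 2a²|u|²`, the `χ'` term costs `|g|²/2 + a²|u|²/2` and the forcing costs `a²|u|²/2`.
  -- The remaining `|g|²/2 + a²|u|²` dominates `|w|²/8`, because `|w|² ≤ 2|g|² + 8a²|u|²`.
  have hmain : ∫ x, (1 / 4 * (W.χ x * ‖w x‖ ^ 2) / 2 - 1 / (2 * a ^ 2) * (W.χ x * ‖f x‖ ^ 2)) ≤ 0 := by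
    rw [← ibp]
    refine integral_mono_ae ((((integrable_energy _ _).const_mul _).div_const _).sub
        ((integrable_energy _ _).const_mul _)) hint ?_
    filter_upwards [hl, hpx] with x hlx hwx
    have e1 : (l x * conj (u x)).re =
        -(f x * conj (u x)).re + (2 * a ^ 2 + 2 * tanhBCF a x ^ 2) * ‖u x‖ ^ 2 := by
      rw [hlx, add_mul, Complex.add_re, mul_assoc, Complex.re_ofReal_mul, re_mul_conj_self,
        neg_mul, Complex.neg_re]
    rw [e1, re_mul_conj_self]
    have hχ := W.nonneg x
    have h1 := (abs_le.1 (abs_re_mul_conj_le (f x) (u x))).2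
    have h2 : W.χ' x * (g x * conj (u x)).re ≥ - (W.χ x * (2 * ε * (‖g x‖ * ‖u x‖))) := by
      have h3 := (abs_le.1 (abs_re_mul_conj_le (g x) (u x))).1
      have h4 := mul_le_mul_of_nonneg_left h3 (W.deriv_nonneg x)
      have h5 := mul_le_mul_of_nonneg_right (W.deriv_le x)
        (mul_nonneg (norm_nonneg (g x)) (norm_nonneg (u x)))
      nlinarith
    have h6 : ‖w x‖ ^ 2 ≤ 2 * ‖g x‖ ^ 2 + 8 * (a ^ 2 * ‖u x‖ ^ 2) := by
      have h7 := norm_sub_sq_le (g x) (2 * tanhBCF a x * u x)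
      rw [← hwx] at h7
      simp only [norm_mul, RCLike.norm_ofNat, Complex.norm_real, Real.norm_eq_abs, mul_pow,
        sq_abs] at h7
      have := mul_le_mul_of_nonneg_right (tanhBCF_sq_le a x) (sq_nonneg ‖u x‖)
      linarith
    have h8 : 2 * ε * (‖g x‖ * ‖u x‖) ≤ ‖g x‖ ^ 2 / 2 + a ^ 2 / 2 * ‖u x‖ ^ 2 := by
      have h9 : 2 * ε * (‖g x‖ * ‖u x‖) ≤ a * (‖g x‖ * ‖u x‖) := by
        gcongr
        linarith
      nlinarith [sq_nonneg (‖g x‖ - a * ‖u x‖)]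
    have h10 : ‖f x‖ * ‖u x‖ ≤ a ^ 2 / 2 * ‖u x‖ ^ 2 + 1 / (2 * a ^ 2) * ‖f x‖ ^ 2 := by
      have e : a ^ 2 / 2 * ‖u x‖ ^ 2 + 1 / (2 * a ^ 2) * ‖f x‖ ^ 2 - ‖f x‖ * ‖u x‖ =
        (a ^ 2 * ‖u x‖ - ‖f x‖) ^ 2 / (2 * a ^ 2) := by field_simp; ring
      have : 0 ≤ (a ^ 2 * ‖u x‖ - ‖f x‖) ^ 2 / (2 * a ^ 2) := by positivity
      linarith
    have h11 : 0 ≤ tanhBCF a x ^ 2 * ‖u x‖ ^ 2 := by positivity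
    have h12 := mul_le_mul_of_nonneg_left (show 1 / 4 * ‖w x‖ ^ 2 / 2 - 1 / (2 * a ^ 2) * ‖f x‖ ^ 2
      ≤ - (2 * ε * (‖g x‖ * ‖u x‖)) + (-(f x * conj (u x)).re +
        (2 * a ^ 2 + 2 * tanhBCF a x ^ 2) * ‖u x‖ ^ 2) + ‖g x‖ ^ 2 by nlinarith) hχ
    nlinarith
  rw [integral_sub (((integrable_energy _ _).const_mul _).div_const _)
    ((integrable_energy _ _).const_mul _), integral_div,
    integral_const_mul, integral_const_mul] at hmain
  change 1 / 4 * energy W.χ w / 2 - 1 / (2 * a ^ 2) * energy W.χ f ≤ 0 at hmain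
  have e : 4 / a ^ 2 * energy W.χ f = 8 * (1 / (2 * a ^ 2) * energy W.χ f) := by field_simp; ring
  rw [e]
  linarith

/-! ### Fourier series in `y` and Parseval -/

/-- Normalized Haar measure on `𝕋`. -/
abbrev haarT : Measure (AddCircle (2 * Real.pi)) := AddCircle.haarAddCircle

theorem two_pi_ne_zero' : ENNReal.ofReal (2 * Real.pi) ≠ 0 := by
  simpa using Real.pi_pos

theorem ae_ae_of_ae_cylinder {P : Cylinder → Prop} (h : ∀ᵐ p : Cylinder, P p) :
    ∀ᵐ x : ℝ, ∀ᵐ y ∂haarT, P (x, y) := by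
  rw [Measure.volume_eq_prod] at h
  filter_upwards [Measure.ae_ae_of_ae_prod h] with x hx
  rw [AddCircle.volume_eq_smul_haarAddCircle] at hx
  exact (Measure.ae_ennreal_smul_measure_iff two_pi_ne_zero').1 hx

theorem lintegral_cylinder {g : Cylinder → ℝ≥0∞} (hg : AEMeasurable g) :
    ∫⁻ p, g p = ENNReal.ofReal (2 * Real.pi) * ∫⁻ x, ∫⁻ y, g (x, y) ∂haarT := by
  rw [Measure.volume_eq_prod] at hg ⊢
  rw [lintegral_prod _ hg, AddCircle.volume_eq_smul_haarAddCircle]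
  simp_rw [lintegral_smul_measure, smul_eq_mul]
  rw [lintegral_const_mul' _ _ ENNReal.ofReal_ne_top]

theorem lintegral_enorm_sq_lt_top {α : Type*} [MeasurableSpace α] {μ : Measure α} {F : α → ℂ}
    (hF : MemLp F 2 μ) : ∫⁻ x, ‖F x‖ₑ ^ 2 ∂μ < ⊤ := by
  have h := lintegral_rpow_enorm_lt_top_of_eLpNorm_lt_top (p := 2) (by norm_num) (by norm_num) hF.2
  simpa using h

theorem memLp_of_lintegral_enorm_sq {α : Type*} [MeasurableSpace α] {μ : Measure α} {F : α → ℂ}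
    (hF : AEStronglyMeasurable F μ) (h : ∫⁻ x, ‖F x‖ₑ ^ 2 ∂μ < ⊤) : MemLp F 2 μ := by
  refine ⟨hF, ?_⟩
  rw [eLpNorm_lt_top_iff_lintegral_rpow_enorm_lt_top (by norm_num) (by norm_num)]
  simpa using h

theorem enorm_sq_eq_lintegral {α : Type*} [MeasurableSpace α] {μ : Measure α} (u : Lp ℂ 2 μ) :
    ‖u‖ₑ ^ 2 = ∫⁻ x, ‖u x‖ₑ ^ 2 ∂μ := by
  rw [Lp.enorm_def, eLpNorm_eq_lintegral_rpow_enorm_toReal (by norm_num) (by norm_num),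
    ← ENNReal.rpow_natCast, ← ENNReal.rpow_mul]
  simp

theorem ae_memLp_slice (u : L2) : ∀ᵐ x : ℝ, MemLp (fun y => u (x, y)) 2 haarT := by
  have hu : StronglyMeasurable (u : Cylinder → ℂ) := Lp.stronglyMeasurable u
  have hm : Measurable fun p : Cylinder => ‖u p‖ₑ ^ 2 := hu.enorm.pow_const 2
  have h := lintegral_enorm_sq_lt_top (Lp.memLp u)
  rw [lintegral_cylinder hm.aemeasurable] at h
  have h2 : ∫⁻ x, ∫⁻ y, ‖u (x, y)‖ₑ ^ 2 ∂haarT ≠ ⊤ := by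
    intro htop
    rw [htop, ENNReal.mul_top two_pi_ne_zero'] at h
    exact lt_irrefl _ h
  filter_upwards [ae_lt_top (hm.lintegral_prod_right') h2] with x hx
  exact memLp_of_lintegral_enorm_sq
    (hu.comp_measurable measurable_prodMk_left).aestronglyMeasurable hx

theorem tsum_enorm_sq_fourierCoeff {f : AddCircle (2 * Real.pi) → ℂ} (hf : MemLp f 2 haarT) :
    ∑' n : ℤ, ‖fourierCoeff f n‖ₑ ^ 2 = ∫⁻ y, ‖f y‖ₑ ^ 2 ∂haarT := by
  have h := hasSum_sq_fourierCoeff (MemLp.toLp f hf)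
  have e : ∀ n, fourierCoeff (MemLp.toLp f hf : AddCircle (2 * Real.pi) → ℂ) n = fourierCoeff f n :=
    fun n => congrFun (fourierCoeff_congr_ae hf.coeFn_toLp) n
  simp_rw [e] at h
  have e2 : ∫ t, ‖MemLp.toLp f hf t‖ ^ 2 ∂haarT = ∫ t, ‖f t‖ ^ 2 ∂haarT := by
    refine integral_congr_ae ?_
    filter_upwards [hf.coeFn_toLp] with x hx
    rw [hx]
  rw [e2] at h
  have hi : Integrable (fun t => ‖f t‖ ^ 2) haarT := (memLp_two_iff_integrable_sq_norm hf.1).1 hf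
  have e3 : ∀ z : ℂ, ‖z‖ₑ ^ 2 = ENNReal.ofReal (‖z‖ ^ 2) := fun z => by
    rw [ENNReal.ofReal_pow (norm_nonneg _), ofReal_norm]
  simp_rw [e3]
  rw [← ENNReal.ofReal_tsum_of_nonneg (fun n => by positivity) h.summable, h.tsum_eq,
    ofReal_integral_eq_lintegral_ofReal hi (ae_of_all _ fun x => by positivity)]

theorem coeFn_mode (u : L2) (n : ℤ) : mode u n =ᵐ[volume] modeFun u n :=
  (memLp_modeFun u n).coeFn_toLp

/-- Parseval's identity in `y`, with a weight in `x`. -/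
theorem lintegral_weight_eq_tsum_mode {ω : ℝ → ℝ≥0∞} (hω : Measurable ω) (u : L2) :
    ∫⁻ p : Cylinder, ω p.1 * ‖u p‖ₑ ^ 2 =
      ENNReal.ofReal (2 * Real.pi) * ∑' n : ℤ, ∫⁻ x, ω x * ‖mode u n x‖ₑ ^ 2 := by
  have hu : StronglyMeasurable (u : Cylinder → ℂ) := Lp.stronglyMeasurable u
  have hmeas : Measurable fun p : Cylinder => ω p.1 * ‖u p‖ₑ ^ 2 :=
    (hω.comp measurable_fst).mul (hu.enorm.pow_const 2)
  rw [lintegral_cylinder hmeas.aemeasurable]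
  congr 1
  have hmode : ∀ n, Measurable fun x => ω x * ‖mode u n x‖ₑ ^ 2 := fun n =>
    hω.mul ((Lp.stronglyMeasurable (mode u n)).enorm.pow_const 2)
  rw [← lintegral_tsum fun n => (hmode n).aemeasurable]
  refine lintegral_congr_ae ?_
  filter_upwards [ae_memLp_slice u, ae_all_iff.2 fun n => coeFn_mode u n] with x hx hmode
  have hslice : Measurable fun y => ‖u (x, y)‖ₑ ^ 2 :=
    (hu.comp_measurable measurable_prodMk_left).enorm.pow_const 2
  rw [lintegral_const_mul _ hslice,
    ← tsum_enorm_sq_fourierCoeff hx, ← ENNReal.tsum_mul_left]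
  refine tsum_congr fun n => ?_
  rw [hmode n]
  rfl

theorem enorm_sq_eq_tsum_mode (u : L2) :
    ‖u‖ₑ ^ 2 = ENNReal.ofReal (2 * Real.pi) * ∑' n : ℤ, ‖mode u n‖ₑ ^ 2 := by
  simp_rw [enorm_sq_eq_lintegral]
  simpa using lintegral_weight_eq_tsum_mode (ω := fun _ => 1) measurable_const u

theorem ae_fourierCoeff_congr {F G : Cylinder → ℂ} (h : F =ᵐ[volume] G) :
    ∀ᵐ x : ℝ, ∀ n, fourierCoeff (fun y => F (x, y)) n = fourierCoeff (fun y => G (x, y)) n := by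
  filter_upwards [ae_ae_of_ae_cylinder h] with x hx n
  exact congrFun (fourierCoeff_congr_ae hx) n

theorem integrable_slice {f : AddCircle (2 * Real.pi) → ℂ} (hf : MemLp f 2 haarT) :
    Integrable f haarT := hf.integrable (by norm_num)

theorem mode_add (u v : L2) (n : ℤ) : mode (u + v) n = mode u n + mode v n := by
  ext1
  filter_upwards [coeFn_mode (u + v) n, coeFn_mode u n, coeFn_mode v n,
    Lp.coeFn_add (mode u n) (mode v n), ae_fourierCoeff_congr (Lp.coeFn_add u v),
    ae_memLp_slice u, ae_memLp_slice v] with x h1 h2 h3 h4 h5 h6 h7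
  rw [h1, h4, Pi.add_apply, h2, h3]
  refine (h5 n).trans ?_
  exact fourierCoeff.add (integrable_slice h6) (integrable_slice h7) |> fun h => congrFun h n

theorem mode_const_smul (c : ℂ) (u : L2) (n : ℤ) : mode (c • u) n = c • mode u n := by
  ext1
  filter_upwards [coeFn_mode (c • u) n, coeFn_mode u n,
    Lp.coeFn_smul c (mode u n), ae_fourierCoeff_congr (Lp.coeFn_smul c u)] with x h1 h2 h3 h4
  rw [h1, h3, Pi.smul_apply, h2]
  refine (h4 n).trans ?_
  exact fourierCoeff.const_smul _ c n

/-- Taking the `n`-th mode, as a continuous linear map. -/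
def modeCLM (n : ℤ) : L2 →L[ℂ] LineL2 :=
  LinearMap.mkContinuous
    { toFun := fun u => mode u n
      map_add' := fun u v => mode_add u v n
      map_smul' := fun c u => mode_const_smul c u n } 1 fun u => by
    have h := enorm_sq_eq_tsum_mode u
    have h1 : ‖mode u n‖ₑ ^ 2 ≤ ‖u‖ₑ ^ 2 := by
      rw [h]
      refine (ENNReal.le_tsum n).trans (le_mul_of_one_le_left zero_le ?_)
      rw [ENNReal.one_le_ofReal]
      linarith [Real.pi_gt_three]
    have h2 : ‖mode u n‖ₑ ≤ ‖u‖ₑ := by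
      by_contra hlt
      exact absurd h1 (not_le.2 (ENNReal.pow_lt_pow_left two_ne_zero (not_le.1 hlt)))
    rw [one_mul]
    exact enorm_le_iff_norm_le.1 h2

@[simp] theorem modeCLM_apply (n : ℤ) (u : L2) : modeCLM n u = mode u n := rfl

theorem memLp_single (g : LineL2) (n : ℤ) :
    MemLp (fun p : Cylinder => g p.1 * (fourier n p.2 : ℂ)) 2 volume := by
  have h : MemLp (fun p : Cylinder => g p.1) 2 volume := (Lp.memLp g).comp_fst volume
  refine h.of_le (h.1.mul ?_) (ae_of_all _ fun p => ?_)
  · exact (((map_continuous (fourier (T := 2 * Real.pi) n)).stronglyMeasurable).comp_measurable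
      measurable_snd).aestronglyMeasurable
  · rw [norm_mul, fourier_apply, Circle.norm_coe, mul_one]

/-- The function `g(x) e^{iny}`. -/
def single (g : LineL2) (n : ℤ) : L2 := (memLp_single g n).toLp _

theorem mode_single (g : LineL2) (n m : ℤ) : mode (single g n) m = if m = n then g else 0 := by
  have h : ∀ᵐ x, mode (single g n) m x = g x * (Pi.single n 1 : ℤ → ℂ) m := by
    filter_upwards [coeFn_mode (single g n) m, ae_fourierCoeff_congr (memLp_single g n).coeFn_toLp]
      with x h1 h2
    rw [h1]
    refine (h2 m).trans ?_
    rw [fourierCoeff.const_mul, fourierCoeff_fourier]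
  ext1
  split_ifs with hmn
  · subst hmn
    filter_upwards [h] with x hx
    rw [hx]; simp
  · filter_upwards [h, Lp.coeFn_zero ℂ 2 (volume : Measure ℝ)] with x hx h0
    rw [hx, h0]; simp [hmn]

/-- A square-summable family of modes comes from a function in `L²(ℝ × 𝕋)`. -/
theorem exists_mode_eq {g : ℤ → LineL2} (hg : ∑' n, ‖g n‖ₑ ^ 2 < ⊤) :
    ∃ u : L2, ∀ n, mode u n = g n := by
  have hsum : Summable fun n => ‖g n‖ ^ 2 := by
    have := ENNReal.summable_toReal hg.ne
    refine this.congr fun n => ?_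
    rw [ENNReal.toReal_pow, toReal_enorm]
  have hnorm : ∀ t : Finset ℤ,
      ‖∑ n ∈ t, single (g n) n‖ ^ 2 = 2 * Real.pi * ∑ n ∈ t, ‖g n‖ ^ 2 := by
    intro t
    have h1 : ∀ m, mode (∑ n ∈ t, single (g n) n) m = if m ∈ t then g m else 0 := by
      intro m
      rw [← modeCLM_apply, map_sum]
      simp_rw [modeCLM_apply, mode_single]
      rw [Finset.sum_ite_eq]
    have h2 := enorm_sq_eq_tsum_mode (∑ n ∈ t, single (g n) n)
    simp_rw [h1] at h2
    rw [tsum_eq_sum (s := t) fun n hn => by simp [hn]] at h2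
    have h3 := congrArg ENNReal.toReal h2
    rw [ENNReal.toReal_pow, toReal_enorm, ENNReal.toReal_mul,
      ENNReal.toReal_ofReal Real.two_pi_pos.le, ENNReal.toReal_sum fun n _ => by simp] at h3
    rw [h3]
    congr 1
    refine Finset.sum_congr rfl fun n hn => ?_
    rw [if_pos hn, ENNReal.toReal_pow, toReal_enorm]
  -- By Parseval for finite sums, tails of the series are controlled by tails of `∑ ‖g n‖²`;
  -- completeness gives the limit.
  have hS : Summable fun n => single (g n) n := by
    rw [summable_iff_vanishing_norm]
    intro ε hε
    obtain ⟨s, hs⟩ := (summable_iff_vanishing_norm.1 hsum) (ε ^ 2 / (2 * Real.pi)) (by positivity)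
    refine ⟨s, fun t ht => ?_⟩
    have h1 := (le_abs_self _).trans_lt (hs t ht)
    rw [lt_div_iff₀ Real.two_pi_pos, mul_comm, ← hnorm] at h1
    exact lt_of_pow_lt_pow_left₀ 2 hε.le h1
  refine ⟨∑' n, single (g n) n, fun m => ?_⟩
  rw [← modeCLM_apply, (modeCLM m).map_tsum hS]
  simp_rw [modeCLM_apply, mode_single]
  simp_rw [eq_comm (a := m)]
  rw [tsum_ite_eq]

/-! ### Fourier multipliers on the cylinder -/

theorem map_div_volume {c : ℝ} (hc : c ≠ 0) :
    Measure.map (fun x : ℝ => x / c) volume = ENNReal.ofReal |c| • volume := by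
  simp_rw [div_eq_mul_inv]
  rw [Real.map_volume_mul_right (inv_ne_zero hc), inv_inv]

theorem ae_comp_div {c : ℝ} (hc : c ≠ 0) {P : ℝ → Prop} (h : ∀ᵐ x, P x) : ∀ᵐ x, P (x / c) := by
  have hq : Measure.QuasiMeasurePreserving (fun x : ℝ => x / c) :=
    ⟨by fun_prop, by rw [map_div_volume hc]; exact Measure.smul_absolutelyContinuous⟩
  exact hq.ae h

theorem ae_of_ae_comp_div {c : ℝ} (hc : c ≠ 0) {P : ℝ → Prop} (h : ∀ᵐ x, P (x / c)) :
    ∀ᵐ x, P x := by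
  have := ae_comp_div (inv_ne_zero hc) h
  filter_upwards [this] with x hx
  rwa [div_inv_eq_mul, mul_div_cancel_right₀ _ hc] at hx

theorem lintegral_comp_div {c : ℝ} (hc : c ≠ 0) {f : ℝ → ℝ≥0∞} (hf : Measurable f) :
    ∫⁻ x, f (x / c) = ENNReal.ofReal |c| * ∫⁻ x, f x := by
  rw [← lintegral_map hf (by fun_prop : Measurable fun x : ℝ => x / c), map_div_volume hc,
    lintegral_smul_measure, smul_eq_mul]

/-- The multiplier is what it should be as soon as the result is square-integrable. -/
theorem hat_multiplier {m : ℝ → ℤ → ℂ} (hm : ∀ n, Measurable fun ξ => m ξ n) {u : L2}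
    (hfin : ∑' n : ℤ, ∫⁻ ξ : ℝ, ‖m ξ n * hat u n ξ‖ₑ ^ 2 < ⊤) (n : ℤ) :
    ∀ᵐ ξ : ℝ, hat (multiplier m u) n ξ = m ξ n * hat u n ξ := by
  have h2π : (2 * Real.pi) ≠ 0 := Real.two_pi_pos.ne'
  -- This excludes the default value `0` in `multiplier`. The function is built mode by mode by
  -- inverse Fourier transform, after rescaling `ξ = 2πη`.
  have hex : ∃ v : L2, ∀ n : ℤ, ∀ᵐ ξ : ℝ, hat v n ξ = m ξ n * hat u n ξ := by
    set G : ℤ → ℝ → ℂ := fun n η => m (η * (2 * Real.pi)) n * (𝓕 (mode u n) : LineL2) η with hG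
    have hGm : ∀ n, StronglyMeasurable (G n) := fun n =>
      (((hm n).comp (by fun_prop : Measurable fun η : ℝ => η * (2 * Real.pi))).stronglyMeasurable).mul
        (Lp.stronglyMeasurable _)
    have hGξ : ∀ n ξ, G n (ξ / (2 * Real.pi)) = m ξ n * hat u n ξ := fun n ξ => by
      simp only [hG, hat]
      rw [div_mul_cancel₀ _ h2π]
    have hint : ∀ n, ∫⁻ ξ : ℝ, ‖m ξ n * hat u n ξ‖ₑ ^ 2 =
        ENNReal.ofReal |2 * Real.pi| * ∫⁻ η, ‖G n η‖ₑ ^ 2 := fun n => by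
      rw [← lintegral_comp_div h2π ((hGm n).enorm.pow_const 2)]
      simp_rw [hGξ]
    simp_rw [hint] at hfin
    rw [ENNReal.tsum_mul_left] at hfin
    have hne : ENNReal.ofReal |2 * Real.pi| ≠ 0 := by
      rw [abs_of_pos Real.two_pi_pos]; exact two_pi_ne_zero'
    have hfin' : ∑' n, ∫⁻ η, ‖G n η‖ₑ ^ 2 < ⊤ := by
      refine lt_top_iff_ne_top.2 fun htop => ?_
      rw [htop, ENNReal.mul_top hne] at hfin
      exact lt_irrefl _ hfin
    have hGL : ∀ n, MemLp (G n) 2 volume := fun n =>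
      memLp_of_lintegral_enorm_sq (hGm n).aestronglyMeasurable
        ((ENNReal.le_tsum n).trans_lt hfin')
    have hnorm : ∀ n, ‖(𝓕⁻ ((hGL n).toLp (G n)) : LineL2)‖ₑ ^ 2 = ∫⁻ η, ‖G n η‖ₑ ^ 2 := fun n => by
      have h1 : ‖(𝓕⁻ ((hGL n).toLp (G n)) : LineL2)‖ₑ = ‖(hGL n).toLp (G n)‖ₑ :=
        (Lp.fourierTransformₗᵢ ℝ ℂ).symm.enorm_map _
      rw [h1, enorm_sq_eq_lintegral]
      refine lintegral_congr_ae ?_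
      filter_upwards [(hGL n).coeFn_toLp] with x hx
      rw [hx]
    obtain ⟨v, hv⟩ := exists_mode_eq (g := fun n => (𝓕⁻ ((hGL n).toLp (G n)) : LineL2))
      (by simp_rw [hnorm]; exact hfin')
    refine ⟨v, fun n => ?_⟩
    filter_upwards [ae_comp_div h2π (hGL n).coeFn_toLp] with ξ hξ
    rw [← hGξ, ← hξ]
    unfold hat
    rw [hv, FourierTransform.fourier_fourierInv_eq]
  unfold multiplier
  rw [dif_pos hex]
  exact hex.choose_spec n

theorem enorm_sq_eq_ofReal (z : ℂ) : ‖z‖ₑ ^ 2 = ENNReal.ofReal (‖z‖ ^ 2) := by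
  rw [ENNReal.ofReal_pow (norm_nonneg _), ofReal_norm]

theorem hat_multiplier_of_mem_spaceE {m : ℝ → ℤ → ℂ} (hm : ∀ n, Measurable fun ξ => m ξ n)
    (hle : ∀ ξ n, ‖m ξ n‖ ^ 2 ≤ 1 + ξ ^ 2 + (ξ ^ 2)⁻¹ * (n : ℝ) ^ 2) {u : L2} (hu : u ∈ spaceE)
    (n : ℤ) : ∀ᵐ ξ : ℝ, hat (multiplier m u) n ξ = m ξ n * hat u n ξ := by
  refine hat_multiplier hm (lt_of_le_of_lt ?_ hu) n
  refine ENNReal.tsum_le_tsum fun n => lintegral_mono fun ξ => ?_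
  rw [enorm_mul, mul_pow, enorm_sq_eq_ofReal (m ξ n)]
  gcongr
  exact hle ξ n

theorem hat_dx {u : L2} (hu : u ∈ spaceE) (n : ℤ) :
    ∀ᵐ ξ : ℝ, hat (dx u) n ξ = Complex.I * ξ * hat u n ξ := by
  refine hat_multiplier_of_mem_spaceE (m := fun ξ _ => Complex.I * ξ)
    (fun n => by fun_prop) (fun ξ n => ?_) hu n
  rw [norm_mul, Complex.norm_I, one_mul, Complex.norm_real, Real.norm_eq_abs, sq_abs]
  have : 0 ≤ (ξ ^ 2)⁻¹ * (n : ℝ) ^ 2 := by positivity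
  linarith

theorem hat_dxInvDy {u : L2} (hu : u ∈ spaceE) (n : ℤ) :
    ∀ᵐ ξ : ℝ, hat (dxInvDy u) n ξ = (Complex.I * ξ)⁻¹ * (Complex.I * n) * hat u n ξ := by
  refine hat_multiplier_of_mem_spaceE (m := fun ξ n => (Complex.I * ξ)⁻¹ * (Complex.I * n))
    (fun n => by fun_prop) (fun ξ n => ?_) hu n
  rw [norm_mul, norm_inv, norm_mul, norm_mul, Complex.norm_I, one_mul, one_mul, Complex.norm_real,
    Real.norm_eq_abs, mul_pow, inv_pow, sq_abs, Complex.norm_intCast, sq_abs]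
  nlinarith [sq_nonneg ξ]

theorem hasL2Deriv_mode_dx {u : L2} (hu : u ∈ spaceE) (n : ℤ) :
    HasL2Deriv (mode u n) (mode (dx u) n) := by
  refine hasL2Deriv_of_fourier (ae_of_ae_comp_div Real.two_pi_pos.ne' ?_)
  filter_upwards [hat_dx hu n] with ξ hξ
  unfold hat at hξ
  rw [hξ]
  have : (Real.pi : ℂ) ≠ 0 := Complex.ofReal_ne_zero.2 Real.pi_ne_zero
  push_cast
  field_simp

theorem hasL2Deriv_mode_dxInvDy {u : L2} (hu : u ∈ spaceE) (n : ℤ) :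
    HasL2Deriv (mode (dxInvDy u) n) ((Complex.I * n) • mode u n) := by
  refine hasL2Deriv_of_fourier (ae_of_ae_comp_div Real.two_pi_pos.ne' ?_)
  have hsmul : (𝓕 ((Complex.I * n : ℂ) • mode u n) : LineL2) = (Complex.I * n : ℂ) • 𝓕 (mode u n) :=
    FourierTransform.fourier_smul _ _
  filter_upwards [hat_dxInvDy hu n, Measure.ae_ne volume (0 : ℝ),
    ae_comp_div Real.two_pi_pos.ne' (Lp.coeFn_smul (Complex.I * n : ℂ) (𝓕 (mode u n)))]
    with ξ hξ h0 h1
  unfold hat at hξ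
  rw [hξ, hsmul, h1, Pi.smul_apply, smul_eq_mul]
  have : (Real.pi : ℂ) ≠ 0 := Complex.ofReal_ne_zero.2 Real.pi_ne_zero
  have h0' : (ξ : ℂ) ≠ 0 := Complex.ofReal_ne_zero.2 h0
  have hI := Complex.I_ne_zero
  push_cast
  field_simp

/-- The symbol `(iξ)⁻¹(in)` vanishes at `n = 0`, so the nonlocal term is absent from the zeroth
mode. -/
theorem mode_dxInvDy_zero {u : L2} (hu : u ∈ spaceE) : mode (dxInvDy u) 0 = 0 := by
  have h : (𝓕 (mode (dxInvDy u) 0) : LineL2) = 0 := by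
    ext1
    refine ae_of_ae_comp_div Real.two_pi_pos.ne' ?_
    filter_upwards [hat_dxInvDy hu 0,
      ae_comp_div Real.two_pi_pos.ne' (Lp.coeFn_zero ℂ 2 (volume : Measure ℝ))] with ξ hξ h0
    unfold hat at hξ
    rw [hξ, h0]
    simp
  have h2 := Lp.norm_fourier_eq (mode (dxInvDy u) 0)
  rw [h, norm_zero] at h2
  exact norm_eq_zero.1 h2.symm

/-! ### The weights `χ_ε` and summation over modes -/

/-- The weight `χ_ε(· + x₀)` as a slowly varying weight. -/
def chiWeight (ε x₀ : ℝ) (hε : 0 ≤ ε) : SlowWeight ε where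
  χ := BoundedContinuousFunction.ofNormedAddCommGroup (fun x => chi ε (x + x₀))
    (by
      have : Continuous Real.tanh :=
        continuous_iff_continuousAt.2 fun x => (hasDerivAt_tanh x).continuousAt
      unfold chi; fun_prop) 1 fun x => by
      have h := abs_lt.1 (Real.abs_tanh_lt_one (ε * (x + x₀)))
      unfold chi
      rw [Real.norm_eq_abs, abs_le]
      constructor <;> linarith [h.1, h.2]
  χ' := BoundedContinuousFunction.ofNormedAddCommGroup
    (fun x => ε * (1 - Real.tanh (ε * (x + x₀)) ^ 2) / 2)
    (by
      have : Continuous Real.tanh :=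
        continuous_iff_continuousAt.2 fun x => (hasDerivAt_tanh x).continuousAt
      fun_prop) ε fun x => by
      have h := abs_lt.1 (Real.abs_tanh_lt_one (ε * (x + x₀)))
      have h1 : 0 ≤ 1 - Real.tanh (ε * (x + x₀)) ^ 2 := by nlinarith [h.1, h.2]
      rw [Real.norm_eq_abs, abs_of_nonneg (by positivity)]
      nlinarith [mul_nonneg hε (sq_nonneg (Real.tanh (ε * (x + x₀))))]
  hasDerivAt x := by
    have h := (((hasDerivAt_tanh (ε * (x + x₀))).comp x
      (((hasDerivAt_id x).add_const x₀).const_mul ε)).const_add 1).div_const 2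
    refine h.congr_deriv ?_
    change _ = ε * (1 - Real.tanh (ε * (x + x₀)) ^ 2) / 2
    ring
  nonneg x := by
    have h := abs_lt.1 (Real.abs_tanh_lt_one (ε * (x + x₀)))
    change 0 ≤ (1 + Real.tanh (ε * (x + x₀))) / 2
    linarith [h.1]
  deriv_nonneg x := by
    have h := abs_lt.1 (Real.abs_tanh_lt_one (ε * (x + x₀)))
    change 0 ≤ ε * (1 - Real.tanh (ε * (x + x₀)) ^ 2) / 2
    have : 0 ≤ 1 - Real.tanh (ε * (x + x₀)) ^ 2 := by nlinarith [h.1, h.2]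
    positivity
  deriv_le x := by
    have h := abs_lt.1 (Real.abs_tanh_lt_one (ε * (x + x₀)))
    change ε * (1 - Real.tanh (ε * (x + x₀)) ^ 2) / 2 ≤
      2 * ε * ((1 + Real.tanh (ε * (x + x₀))) / 2)
    -- With `t` the hyperbolic tangent, `2(1 + t) - (1 - t²) = (1 + t)²`.
    have : 0 ≤ (1 + Real.tanh (ε * (x + x₀))) * (1 + Real.tanh (ε * (x + x₀))) := by
      nlinarith [h.1]
    nlinarith [mul_nonneg hε this]

/-- The square of the weighted norm on the cylinder. -/
def cylEnergy (χ : ℝ →ᵇ ℝ) (u : L2) : ℝ := ∫ p : Cylinder, χ p.1 * ‖u p‖ ^ 2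

theorem integrable_cylEnergy (χ : ℝ →ᵇ ℝ) (u : L2) :
    Integrable fun p : Cylinder => χ p.1 * ‖u p‖ ^ 2 :=
  ((memLp_two_iff_integrable_sq_norm (Lp.memLp u).1).1 (Lp.memLp u)).bdd_mul (c := ‖χ‖)
    (χ.continuous.comp continuous_fst).aestronglyMeasurable
    (ae_of_all _ fun p => χ.norm_coe_le_norm p.1)

theorem cylEnergy_nonneg {χ : ℝ →ᵇ ℝ} (hχ : ∀ x, 0 ≤ χ x) (u : L2) : 0 ≤ cylEnergy χ u :=
  integral_nonneg fun p => mul_nonneg (hχ p.1) (by positivity)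

/-- Weighted Parseval; with extended nonnegative values, modewise bounds sum without summability
side conditions. -/
theorem ofReal_cylEnergy {χ : ℝ →ᵇ ℝ} (hχ : ∀ x, 0 ≤ χ x) (u : L2) :
    ENNReal.ofReal (cylEnergy χ u) =
      ENNReal.ofReal (2 * Real.pi) * ∑' n, ENNReal.ofReal (energy χ (mode u n)) := by
  have h1 : ∀ n, ENNReal.ofReal (energy χ (mode u n)) =
      ∫⁻ x, ENNReal.ofReal (χ x) * ‖mode u n x‖ₑ ^ 2 := fun n => by
    unfold energy
    rw [ofReal_integral_eq_lintegral_ofReal (integrable_energy χ _)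
      (ae_of_all _ fun x => mul_nonneg (hχ x) (by positivity))]
    refine lintegral_congr fun x => ?_
    rw [ENNReal.ofReal_mul (hχ x), enorm_sq_eq_ofReal]
  simp_rw [h1]
  rw [← lintegral_weight_eq_tsum_mode (χ.continuous.measurable.ennreal_ofReal) u]
  unfold cylEnergy
  rw [ofReal_integral_eq_lintegral_ofReal (integrable_cylEnergy χ u)
      (ae_of_all _ fun p => mul_nonneg (hχ p.1) (by positivity))]
  refine lintegral_congr fun p => ?_
  rw [ENNReal.ofReal_mul (hχ p.1), enorm_sq_eq_ofReal]

theorem cylEnergy_le_of_mode {χ : ℝ →ᵇ ℝ} (hχ : ∀ x, 0 ≤ χ x) {u f : L2} {K : ℝ} (hK : 0 ≤ K)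
    (h : ∀ n, energy χ (mode u n) ≤ K * energy χ (mode f n)) :
    cylEnergy χ u ≤ K * cylEnergy χ f := by
  have hf := cylEnergy_nonneg hχ f
  refine (ENNReal.ofReal_le_ofReal_iff (by positivity)).1 ?_
  rw [ENNReal.ofReal_mul hK, ofReal_cylEnergy hχ, ofReal_cylEnergy hχ, mul_left_comm]
  refine mul_le_mul' le_rfl ?_
  rw [← ENNReal.tsum_mul_left]
  refine ENNReal.tsum_le_tsum fun n => ?_
  rw [← ENNReal.ofReal_mul hK]
  exact ENNReal.ofReal_le_ofReal (h n)

theorem weightedL2Norm_eq {ε x₀ : ℝ} (hε : 0 ≤ ε) (u : L2) :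
    weightedL2Norm ε x₀ u = √(cylEnergy (chiWeight ε x₀ hε).χ u) := rfl

/-! ### The operator `𝓛_c` on modes and the coercivity estimate -/

theorem kink_eq_tanhBCF (c x : ℝ) : kink c x = tanhBCF √(c / 2) x := rfl

theorem deriv_kink (c x : ℝ) : deriv (kink c) x = sechSqBCF √(c / 2) x :=
  (hasDerivAt_tanhBCF √(c / 2) x).deriv

theorem memLp_linOp (c : ℝ) (u : L2) : MemLp (linOp c u) 2 volume := by
  have hQ : MemLp (fun p : Cylinder => 2 * (kink c p.1 : ℂ) * u p) 2 volume := by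
    refine (Lp.memLp u).of_le_mul (c := 2 * ‖tanhBCF √(c / 2)‖)
      (AEStronglyMeasurable.mul ?_ (Lp.aestronglyMeasurable u)) (ae_of_all _ fun p => ?_)
    · exact (continuous_const.mul (Complex.continuous_ofReal.comp
        ((tanhBCF √(c / 2)).continuous.comp continuous_fst))).aestronglyMeasurable
    · rw [norm_mul, norm_mul, RCLike.norm_ofNat, Complex.norm_real]
      gcongr
      exact (tanhBCF √(c / 2)).norm_coe_le_norm p.1
  exact ((Lp.memLp (dx u)).neg.add (Lp.memLp (dxInvDy u))).sub hQ

theorem coeFn_mode_linOp (c : ℝ) (u : L2) (n : ℤ) :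
    ∀ᵐ x, mode ((memLp_linOp c u).toLp _) n x =
      -mode (dx u) n x + mode (dxInvDy u) n x - 2 * tanhBCF √(c / 2) x * mode u n x := by
  filter_upwards [coeFn_mode ((memLp_linOp c u).toLp _) n, coeFn_mode (dx u) n,
    coeFn_mode (dxInvDy u) n, coeFn_mode u n, ae_fourierCoeff_congr (memLp_linOp c u).coeFn_toLp,
    ae_memLp_slice u, ae_memLp_slice (dx u), ae_memLp_slice (dxInvDy u)]
    with x h1 h2 h3 h4 h5 i1 i2 i3
  rw [h1, h2, h3, h4]
  refine (h5 n).trans ?_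
  have j1 := integrable_slice i1
  have j2 := integrable_slice i2
  have j3 := integrable_slice i3
  have e : (fun y => linOp c u (x, y)) =
      ((-1 : ℂ) • (fun y => dx u (x, y)) + fun y => dxInvDy u (x, y)) +
        ((-(2 * tanhBCF √(c / 2) x) : ℂ) • fun y => u (x, y)) := by
    funext y
    simp only [linOp, Pi.add_apply, Pi.smul_apply, smul_eq_mul, kink_eq_tanhBCF]
    ring
  rw [e, fourierCoeff.add ((j2.smul _).add j3) (j1.smul _), fourierCoeff.add (j2.smul _) j3,
    Pi.add_apply, Pi.add_apply, fourierCoeff.const_smul, fourierCoeff.const_smul]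
  simp only [smul_eq_mul, modeFun]
  ring

/-- `Q'` does not depend on `y`, so integrating first in `y` leaves a condition on the zeroth mode
alone. -/
theorem integral_mode_zero_of_mem_kinkPerp {c : ℝ} (hc : 0 < c) {w : L2} (hw : w ∈ kinkPerp c) :
    ∫ x, (sechSqBCF √(c / 2) x : ℂ) * mode w 0 x = 0 := by
  have ha : 0 < √(c / 2) := Real.sqrt_pos.2 (by positivity)
  have hS : MemLp (fun p : Cylinder => (sechSqBCF √(c / 2) p.1 : ℂ)) 2 volume :=
    (memLp_sechSq ha).comp_fst volume
  have hi : Integrable fun p : Cylinder => (sechSqBCF √(c / 2) p.1 : ℂ) * w p :=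
    hS.integrable_mul (Lp.memLp w)
  have h0 : ∫ p : Cylinder, (sechSqBCF √(c / 2) p.1 : ℂ) * w p = 0 := by
    have := hw
    unfold kinkPerp at this
    simpa only [Set.mem_ofPred_eq, deriv_kink] using this
  replace h0 := (integral_prod (μ := (volume : Measure ℝ))
    (ν := (volume : Measure (AddCircle (2 * Real.pi)))) _ hi).symm.trans h0
  have e : ∀ x, ∫ y, (sechSqBCF √(c / 2) x : ℂ) * w (x, y) =
      (2 * Real.pi : ℝ) * ((sechSqBCF √(c / 2) x : ℂ) * modeFun w 0 x) := fun x => by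
    rw [integral_const_mul]
    unfold modeFun fourierCoeff
    simp only [neg_zero, fourier_zero, one_smul]
    rw [AddCircle.integral_haarAddCircle, Complex.real_smul]
    have : (Real.pi : ℂ) ≠ 0 := Complex.ofReal_ne_zero.2 Real.pi_ne_zero
    push_cast
    field_simp
  simp_rw [e] at h0
  rw [integral_const_mul] at h0
  have h2π : ((2 * Real.pi : ℝ) : ℂ) ≠ 0 := Complex.ofReal_ne_zero.2 Real.two_pi_pos.ne'
  rw [← (mul_eq_zero.1 h0).resolve_left h2π]
  refine integral_congr_ae ?_
  filter_upwards [coeFn_mode w 0] with x hx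
  rw [hx]

theorem cylEnergy_le_of_ae {χ : ℝ →ᵇ ℝ} (hχ : ∀ x, 0 ≤ χ x) {h p q r : L2} {A B D : ℝ}
    (hle : ∀ᵐ x, ‖h x‖ ^ 2 ≤ A * ‖p x‖ ^ 2 + B * ‖q x‖ ^ 2 + D * ‖r x‖ ^ 2) :
    cylEnergy χ h ≤ A * cylEnergy χ p + B * cylEnergy χ q + D * cylEnergy χ r := by
  have hi : Integrable fun x : Cylinder => A * (χ x.1 * ‖p x‖ ^ 2) + B * (χ x.1 * ‖q x‖ ^ 2) :=
    ((integrable_cylEnergy χ p).const_mul A).add ((integrable_cylEnergy χ q).const_mul B)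
  have hj := (integrable_cylEnergy χ r).const_mul D
  unfold cylEnergy
  rw [← integral_const_mul, ← integral_const_mul, ← integral_const_mul, ← integral_add
    ((integrable_cylEnergy χ p).const_mul A) ((integrable_cylEnergy χ q).const_mul B),
    ← integral_add hi hj]
  refine integral_mono_ae (integrable_cylEnergy χ h) (hi.add hj) ?_
  filter_upwards [hle] with x hx
  have := mul_le_mul_of_nonneg_left hx (hχ x.1)
  linarith

theorem norm_sub_sub_sq_le (x y z : ℂ) :
    ‖x - y - z‖ ^ 2 ≤ 4 * ‖x‖ ^ 2 + 4 * ‖y‖ ^ 2 + 2 * ‖z‖ ^ 2 := by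
  linarith [norm_sub_sq_le (x - y) z, norm_sub_sq_le x y]

/-- The squared form of the coercivity estimate, for a general slowly varying weight. -/
theorem exists_cylEnergy_le {c : ℝ} (hc : 0 < c) :
    ∃ ε₀ : ℝ, 0 < ε₀ ∧ ∃ K : ℝ, 0 < K ∧ ∀ ε ≤ ε₀, ∀ W : SlowWeight ε,
      ∀ w ∈ spaceE ∩ kinkPerp c,
        cylEnergy W.χ w ≤ K * cylEnergy W.χ ((memLp_linOp c w).toLp _) ∧
        cylEnergy W.χ (dx w) ≤ K * cylEnergy W.χ ((memLp_linOp c w).toLp _) ∧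
        cylEnergy W.χ (dxInvDy w) ≤ K * cylEnergy W.χ ((memLp_linOp c w).toLp _) := by
  set a := √(c / 2)
  have ha : 0 < a := Real.sqrt_pos.2 (by positivity)
  obtain ⟨ε₁, hε₁, K₁, hK₁, hest⟩ := nonzero_mode_estimate ha
  set K₂ := K₁ + 4 / a ^ 2 with hK₂
  have hK₂pos : 0 < K₂ := by positivity
  refine ⟨min ε₁ (a / 2), lt_min hε₁ (by positivity), 5 * K₂ + 16 * a ^ 2 * K₂ + 2, by positivity,
    fun ε hε W w hw => ?_⟩
  obtain ⟨hwE, hwP⟩ := hw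
  set f : L2 := (memLp_linOp c w).toLp _
  have hmodes : ∀ n, energy W.χ (mode (dxInvDy w) n) ≤ K₂ * energy W.χ (mode f n) ∧
      energy W.χ (mode w n) ≤ K₂ * energy W.χ (mode f n) := by
    intro n
    have hEf := energy_nonneg W.nonneg (mode f n)
    have ha4 : 0 ≤ 4 / a ^ 2 * energy W.χ (mode f n) := by positivity
    have hK₁E : 0 ≤ K₁ * energy W.χ (mode f n) := by positivity
    have hf := coeFn_mode_linOp c w n
    rw [hK₂, add_mul]
    by_cases hn : n = 0
    · subst hn
      have hv := mode_dxInvDy_zero hwE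
      have hv0 : energy W.χ (mode (dxInvDy w) 0) = 0 := by
        have := energy_const_smul W.χ 0 (mode (dxInvDy w) 0)
        rw [zero_smul, norm_zero] at this
        rw [hv, this]
        ring
      refine ⟨by rw [hv0]; linarith, ?_⟩
      have := zero_mode_estimate ha (hε.trans (min_le_right _ _)) W (hasL2Deriv_mode_dx hwE 0)
        (integral_mode_zero_of_mem_kinkPerp hc hwP) (f := mode f 0) (by
          filter_upwards [hf, Lp.coeFn_zero ℂ 2 (volume : Measure ℝ)] with x hx h0
          rw [hx, hv, h0, Pi.zero_apply, add_zero])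
      linarith
    · obtain ⟨h1, h2⟩ := hest ε (hε.trans (min_le_left _ _)) W n hn _ _ _ _
        (hasL2Deriv_mode_dxInvDy hwE n) (hasL2Deriv_mode_dx hwE n) hf
      exact ⟨by linarith, by linarith⟩
  have hv := cylEnergy_le_of_mode W.nonneg hK₂pos.le fun n => (hmodes n).1
  have hw := cylEnergy_le_of_mode W.nonneg hK₂pos.le fun n => (hmodes n).2
  have hE := cylEnergy_nonneg W.nonneg f
  -- No separate estimate is needed: `∂_x w = ∂_x⁻¹∂_y w - 2Qw - 𝓛_c w` with `|Q| ≤ a`.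
  have hd : cylEnergy W.χ (dx w) ≤ 4 * cylEnergy W.χ (dxInvDy w) + 16 * a ^ 2 * cylEnergy W.χ w
      + 2 * cylEnergy W.χ f := by
    refine cylEnergy_le_of_ae W.nonneg ?_
    filter_upwards [(memLp_linOp c w).coeFn_toLp] with p hp
    have e : dx w p = dxInvDy w p - 2 * tanhBCF a p.1 * w p - f p := by
      rw [hp]
      simp only [linOp, kink_eq_tanhBCF]
      ring
    have h1 := norm_sub_sub_sq_le (dxInvDy w p) (2 * tanhBCF a p.1 * w p) (f p)
    rw [← e] at h1
    simp only [norm_mul, RCLike.norm_ofNat, Complex.norm_real, Real.norm_eq_abs, mul_pow,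
        sq_abs] at h1
    have h2 := mul_le_mul_of_nonneg_right (tanhBCF_sq_le a p.1) (sq_nonneg ‖w p‖)
    linarith
  have h1 : 0 ≤ K₂ * cylEnergy W.χ f := by positivity
  have h2 : 16 * a ^ 2 * cylEnergy W.χ w ≤ 16 * a ^ 2 * (K₂ * cylEnergy W.χ f) := by gcongr
  have h3 : 0 ≤ 16 * a ^ 2 * (K₂ * cylEnergy W.χ f) := by positivity
  refine ⟨?_, ?_, ?_⟩ <;> linarith

end KP

end

theorem lemma3p4 (c : ℝ) (hc : 0 < c) :
    ∃ ε₀ : ℝ, 0 < ε₀ ∧ ∃ C : ℝ, 0 < C ∧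
      ∀ ε ∈ Set.Ioo 0 ε₀, ∀ x₀ : ℝ, ∀ w ∈ KP.spaceE ∩ KP.kinkPerp c,
        C * KP.weightedENorm ε x₀ w ≤ KP.weightedL2Norm ε x₀ (KP.linOp c w) := by
  obtain ⟨ε₀, hε₀, K, hK, h⟩ := KP.exists_cylEnergy_le hc
  -- Each of the three norms in the sum is at most `√K` times the norm of `𝓛_c w`.
  refine ⟨ε₀, hε₀, 1 / (3 * √K), by positivity, fun ε hε x₀ w hw => ?_⟩
  obtain ⟨h1, h2, h3⟩ := h ε hε.2.le (KP.chiWeight ε x₀ hε.1.le) w hw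
  have hf : KP.weightedL2Norm ε x₀ (KP.linOp c w) =
      √(KP.cylEnergy (KP.chiWeight ε x₀ hε.1.le).χ ((KP.memLp_linOp c w).toLp _)) := by
    unfold KP.weightedL2Norm KP.cylEnergy
    congr 1
    refine MeasureTheory.integral_congr_ae ?_
    filter_upwards [(KP.memLp_linOp c w).coeFn_toLp] with p hp
    rw [hp]
    rfl
  rw [hf]
  unfold KP.weightedENorm
  rw [KP.weightedL2Norm_eq hε.1.le, KP.weightedL2Norm_eq hε.1.le, KP.weightedL2Norm_eq hε.1.le]
  have hsq {t s : ℝ} (ht : t ≤ K * s) : √t ≤ √K * √s :=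
    (Real.sqrt_le_sqrt ht).trans_eq (Real.sqrt_mul hK.le _)
  have k1 := hsq h1
  have k2 := hsq h2
  have k3 := hsq h3
  have hKs : 0 < √K := Real.sqrt_pos.2 hK
  rw [one_div, inv_mul_eq_div, div_le_iff₀ (by positivity)]
  linarith
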